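/- Let $p$ be an odd prime, let $\mathbb Z_{(p)}$ be the ring of rational numbers whose denominator (in lowest terms) is not divisible by $p$, and let $u\in\mathbb Z_{(p)}$. For rational numbers $a,b$ and $m\in\{p,p^2\}$ write $a\equiv b\pmod m$ if $a-b\in m\,\mathbb Z_{(p)}$. (i) If $u\not\equiv \frac14 \pmod p$, $u\not\equiv\frac1{16}\pmod p$ and $$\sum_{k=0}^{p-1}\binom{2k}k^2\binom{3k}k\left(\frac{u^2}{(1-4u)^3}\right)^k\equiv 0\pmod p,$$ then $$\sum_{k=0}^{p-1}\binom{2k}k^2\binom{3k}k\left(\frac{-u}{(1-16u)^3}\right)^k\equiv 0\pmod{p^2}.$$ (ii) If $u\not\equiv -\frac13\pmod p$, $u\not\equiv-\frac1{27}\pmod p$ and $$\sum_{k=0}^{p-1}\binom{2k}k^2\binom{4k}{2k}\left(\frac{u^3}{(1+3u)^4}\right)^k\equiv 0\pmod p,$$ then $$\sum_{k=0}^{p-1}\binom{2k}k^2\binom{4k}{2k}\left(\frac{u}{(1+27u)^4}\right)^k\equiv 0\pmod{p^2}.$$ (For $p=3$ the two non-congruences in (ii) hold for every $u\in\mathbb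 Z_{(3)}$.) -/

import Mathlib

/-- The rational number `x` lies in `ℤ_(p)`: its denominator in lowest terms is not divisible
by `p`. -/
def PIntegral (p : ℕ) (x : ℚ) : Prop := ¬ p ∣ x.den

/-- Congruence of rational numbers modulo `m` with respect to `ℤ_(p)`: the difference `a - b`
lies in `m ℤ_(p)`. It is used for `m = p` and `m = p ^ 2`. -/
def PCong (p m : ℕ) (a b : ℚ) : Prop := ∃ c : ℚ, PIntegral p c ∧ a - b = (m : ℚ) * c

/-- The sum `∑_{k=0}^{p-1} C(2k,k)² C(3k,k) x^k`. -/
def cubicSum (p : ℕ) (x : ℚ) : ℚ :=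
  ∑ k ∈ Finset.range p, ((2 * k).choose k : ℚ) ^ 2 * ((3 * k).choose k : ℚ) * x ^ k

/-- The sum `∑_{k=0}^{p-1} C(2k,k)² C(4k,2k) x^k`. -/
def quarticSum (p : ℕ) (x : ℚ) : ℚ :=
  ∑ k ∈ Finset.range p, ((2 * k).choose k : ℚ) ^ 2 * ((4 * k).choose (2 * k) : ℚ) * x ^ k

/-! Write c_k for either coefficient sequence and y for its truncated polynomial `truncSeries c p`.
The proof combines a congruence modulo p between the two sums with a principle lifting a zero of y
from p to p².

For the congruence, the power series ∑ c_k s^k x^(ak) (1 - mx)^(-(a+b)k-1) is the same for both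
choices of (s, m, a, b): its coefficients obey one three-term recurrence, found by creative
telescoping, with the same first two values. They are the Domb numbers in the cubic case and the
Almkvist–Zudilin numbers in the quartic case. Modulo p, Fermat's theorem turns the negative powers
of 1 - mx into polynomials, and the identity descends to the truncated sums (`ZMod.cubic_sum_eq`,
`ZMod.quartic_sum_eq`).

For the lift, y nearly satisfies a third order equation that is a symmetric square, so the quadratic
first integral J of `clausenIntegral` is divisible by p² (`dvd_clausenIntegral_truncSeries`). If p ∣
y(T) at a nonsingular point, J(T) ≡ 0 forces p ∣ y'(T), and then modulo p² only the term in
y(T)y''(T) survives; y''(T) is a unit because a zero of a solution there has multiplicity at most 2.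
At the singular point 2hT ≡ 1 the argument needs 1 - 2hT to vanish modulo p²
(`sq_dvd_eval_truncSeries`).

That last condition follows from the parametrization: 1 - 2hT' is, modulo p² and up to a unit, a
square times a cofactor. In the cubic case the cofactor is a unit by hypothesis. In the quartic case
a zero of the cofactor makes -2 a square modulo p, while a zero of y at the singular point makes
⌊p/4⌋ odd; these are incompatible modulo 8. -/

/-! ### Power series expansions and creative telescoping -/

/-- The coefficient `m ^ j / j!` of the exponential series, extended by zero to `j < 0`. -/
def expCoeff (m : ℚ) (j : ℤ) : ℚ := if j < 0 then 0 else m ^ j.toNat / (j.toNat.factorial : ℚ)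

theorem expCoeff_of_neg (m : ℚ) {j : ℤ} (hj : j < 0) : expCoeff m j = 0 := if_pos hj

theorem expCoeff_natCast (m : ℚ) (j : ℕ) : expCoeff m j = m ^ j / (j.factorial : ℚ) := by
  simp [expCoeff]

theorem expCoeff_succ (m : ℚ) (j : ℤ) :
    ((j : ℚ) + 1) * expCoeff m (j + 1) = m * expCoeff m j := by
  rcases lt_trichotomy j (-1) with h | rfl | h
  · rw [expCoeff_of_neg m (by omega), expCoeff_of_neg m (by omega)]; simp
  · rw [expCoeff_of_neg m (by omega : (-1 : ℤ) < 0)]; simp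
  · lift j to ℕ using by omega
    have h1 : ((j : ℤ) + 1) = ((j + 1 : ℕ) : ℤ) := by push_cast; ring
    rw [h1, expCoeff_natCast, expCoeff_natCast, Nat.factorial_succ]
    have : (j.factorial : ℚ) ≠ 0 := by exact_mod_cast j.factorial_ne_zero
    have : (j : ℚ) + 1 ≠ 0 := by positivity
    push_cast
    field_simp
    ring

theorem expCoeff_eq_succ {m : ℚ} (hm : m ≠ 0) (j : ℤ) :
    expCoeff m j = ((j : ℚ) + 1) / m * expCoeff m (j + 1) := by
  have := expCoeff_succ m j
  field_simp
  linarith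

/-- The coefficient of `x ^ N` in the expansion of
`∑ k, c k * s ^ k * x ^ (a * k) * (1 - m * x) ^ (-(a + b) * k - 1)`. -/
def expansionCoeff (c : ℕ → ℕ) (s m : ℤ) (a b N : ℕ) : ℤ :=
  ∑ k ∈ Finset.range (N + 1),
    (c k : ℤ) * s ^ k * ((N + b * k).choose ((a + b) * k) : ℤ) * m ^ (N - a * k)

/-- The summand of `expansionCoeff`, written with factorials. -/
def expansionTerm (c : ℕ → ℕ) (s m : ℤ) (a b N k : ℕ) : ℚ :=
  (c k : ℚ) / (((a + b) * k).factorial : ℚ) * (s : ℚ) ^ k * ((N + b * k).factorial : ℚ)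
    * expCoeff m ((N : ℤ) - a * k)

theorem expansionCoeff_eq_sum (c : ℕ → ℕ) (s m : ℤ) (a b N : ℕ) :
    (expansionCoeff c s m a b N : ℚ) = ∑ k ∈ Finset.range (N + 1), expansionTerm c s m a b N k := by
  unfold expansionCoeff
  push_cast
  refine Finset.sum_congr rfl fun k _ => ?_
  unfold expansionTerm
  rcases lt_or_ge N (a * k) with h | h
  · rw [expCoeff_of_neg _ (by zify at h; omega),
      Nat.choose_eq_zero_of_lt (by rw [add_mul]; omega)]
    simp
  · have e : ((N : ℤ) - a * k) = ((N - a * k : ℕ) : ℤ) := by zify [h]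
    rw [e, expCoeff_natCast, Nat.cast_choose ℚ (by rw [add_mul]; omega)]
    have e2 : N + b * k - (a + b) * k = N - a * k := by rw [add_mul]; omega
    rw [e2]
    ring

theorem expansionTerm_eq_zero (c : ℕ → ℕ) (s m : ℤ) {a : ℕ} (ha : 0 < a) (b : ℕ) {N k : ℕ}
    (h : N < k) : expansionTerm c s m a b N k = 0 := by
  have : k ≤ a * k := Nat.le_mul_of_pos_left k ha
  unfold expansionTerm
  rw [expCoeff_of_neg _ (by zify at this h; omega), mul_zero]

/-- Creative telescoping: a relation between the summands, up to a telescoping term, yields a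
three-term recurrence for the sums. -/
theorem expansionCoeff_recurrence {c : ℕ → ℕ} {s m : ℤ} {a : ℕ} (ha : 0 < a) {b N : ℕ}
    {P Q R : ℚ} (G : ℕ → ℚ) (h0 : G 0 = 0) (h1 : G (N + 3) = 0)
    (h : ∀ k, P * expansionTerm c s m a b N k + Q * expansionTerm c s m a b (N + 1) k
      + R * expansionTerm c s m a b (N + 2) k = G (k + 1) - G k) :
    P * expansionCoeff c s m a b N + Q * expansionCoeff c s m a b (N + 1)
      + R * expansionCoeff c s m a b (N + 2) = 0 := by
  have e : ∀ M ≤ N + 2, (expansionCoeff c s m a b M : ℚ)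
      = ∑ k ∈ Finset.range (N + 3), expansionTerm c s m a b M k := fun M hM => by
    rw [expansionCoeff_eq_sum]
    refine Finset.sum_subset (Finset.range_mono (by omega)) fun k _ hk => ?_
    exact expansionTerm_eq_zero c s m ha b (by simpa using hk)
  rw [e N (by omega), e (N + 1) (by omega), e (N + 2) le_rfl, Finset.mul_sum, Finset.mul_sum,
    Finset.mul_sum, ← Finset.sum_add_distrib, ← Finset.sum_add_distrib,
    Finset.sum_congr rfl fun k _ => h k, Finset.sum_range_sub, h0, h1, sub_zero]

theorem eq_of_recurrence {f g : ℕ → ℤ} {P Q R : ℕ → ℚ} (hR : ∀ n, R n ≠ 0)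
    (hf : ∀ n, P n * f n + Q n * f (n + 1) + R n * f (n + 2) = 0)
    (hg : ∀ n, P n * g n + Q n * g (n + 1) + R n * g (n + 2) = 0)
    (h0 : f 0 = g 0) (h1 : f 1 = g 1) (n : ℕ) : f n = g n := by
  induction n using Nat.twoStepInduction with
  | zero => exact h0
  | one => exact h1
  | more n ih ih' =>
    have h2 := hf n
    have h3 := hg n
    rw [ih, ih'] at h2
    have : R n * f (n + 2) = R n * g (n + 2) := by linarith
    exact_mod_cast mul_left_cancel₀ (hR n) this

/-! ### The two coefficient sequences and the common recurrences -/

/-- The coefficients `C(2k,k)² C(3k,k)` of `cubicSum`. -/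
def cubicCoeff (k : ℕ) : ℕ := (2 * k).choose k ^ 2 * (3 * k).choose k

/-- The coefficients `C(2k,k)² C(4k,2k)` of `quarticSum`. -/
def quarticCoeff (k : ℕ) : ℕ := (2 * k).choose k ^ 2 * (4 * k).choose (2 * k)

theorem cubicCoeff_eq (k : ℕ) : (cubicCoeff k : ℚ)
    = ((2 * k).factorial : ℚ) * ((3 * k).factorial : ℚ) / (k.factorial : ℚ) ^ 5 := by
  unfold cubicCoeff
  push_cast
  rw [Nat.cast_choose ℚ (by omega : k ≤ 2 * k), Nat.cast_choose ℚ (by omega : k ≤ 3 * k),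
    (by omega : 2 * k - k = k), (by omega : 3 * k - k = 2 * k)]
  have := fun j : ℕ => (Nat.cast_ne_zero (R := ℚ)).2 j.factorial_ne_zero
  have h1 := this k
  have h2 := this (2 * k)
  field_simp

theorem quarticCoeff_eq (k : ℕ) : (quarticCoeff k : ℚ)
    = ((4 * k).factorial : ℚ) / (k.factorial : ℚ) ^ 4 := by
  unfold quarticCoeff
  push_cast
  rw [Nat.cast_choose ℚ (by omega : k ≤ 2 * k), Nat.cast_choose ℚ (by omega : 2 * k ≤ 4 * k),
    (by omega : 2 * k - k = k), (by omega : 4 * k - 2 * k = 2 * k)]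
  have := fun j : ℕ => (Nat.cast_ne_zero (R := ℚ)).2 j.factorial_ne_zero
  have h1 := this k
  have h2 := this (2 * k)
  field_simp

theorem cast_factorial_succ (k : ℕ) : ((k + 1).factorial : ℚ) = (k + 1) * (k.factorial : ℚ) := by
  rw [Nat.factorial_succ]; push_cast; ring

theorem cast_factorial_add_two (k : ℕ) :
    ((k + 2).factorial : ℚ) = (k + 2) * ((k + 1) * (k.factorial : ℚ)) := by
  rw [Nat.factorial_succ, Nat.factorial_succ]; push_cast; ring

theorem cast_factorial_add_three (k : ℕ) :
    ((k + 3).factorial : ℚ) = (k + 3) * ((k + 2) * ((k + 1) * (k.factorial : ℚ))) := by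
  rw [Nat.factorial_succ, Nat.factorial_succ, Nat.factorial_succ]; push_cast; ring

/-- This is the recurrence of the Domb numbers. The companion expansion satisfies the same one with
another certificate. -/
theorem cubicCoeff_recurrence_two_one (n : ℕ) :
    64 * ((n : ℚ) + 1) ^ 3 * expansionCoeff cubicCoeff 1 4 2 1 n
      + -2 * (2 * (n : ℚ) + 3) * (5 * ((n : ℚ) + 2) ^ 2 - 5 * ((n : ℚ) + 2) + 2)
        * expansionCoeff cubicCoeff 1 4 2 1 (n + 1)
      + ((n : ℚ) + 2) ^ 3 * expansionCoeff cubicCoeff 1 4 2 1 (n + 2) = 0 := by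
  -- The telescoping certificate. The factor k^4 gives G 0 = 0, and after k ↦ k + 1 it cancels the
  -- new factors in the denominator. Every summand is then a rational multiple of the single value
  -- `expCoeff 4 (n + 2 - 2k)`, so the claim becomes a polynomial identity.
  refine expansionCoeff_recurrence two_pos (fun k => (k : ℚ) ^ 4 * (-36 * n - 48) *
    (((2 * k).factorial : ℚ) / (k.factorial : ℚ) ^ 5 * ((n + k).factorial : ℚ)
      * expCoeff 4 ((n : ℤ) + 2 - 2 * k))) (by simp) ?_ fun k => ?_
  · rw [expCoeff_of_neg _ (by push_cast; omega)]; simp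
  · have hk := (Nat.cast_ne_zero (R := ℚ)).2 k.factorial_ne_zero
    have hk1 : (k : ℚ) + 1 ≠ 0 := by positivity
    have hk3 := (Nat.cast_ne_zero (R := ℚ)).2 (3 * k).factorial_ne_zero
    have w1 : expCoeff 4 ((n : ℤ) + 1 - 2 * k)
        = ((n : ℚ) + 2 - 2 * k) / 4 * expCoeff 4 ((n : ℤ) + 2 - 2 * k) := by
      rw [expCoeff_eq_succ (by norm_num)]; push_cast; ring_nf
    have w0 : expCoeff 4 ((n : ℤ) - 2 * k)
        = ((n : ℚ) + 1 - 2 * k) / 4 * expCoeff 4 ((n : ℤ) + 1 - 2 * k) := by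
      rw [expCoeff_eq_succ (by norm_num)]; push_cast; ring_nf
    have w2 : expCoeff 4 ((n : ℤ) + 2 - 2 * (k + 1 : ℕ)) = expCoeff 4 ((n : ℤ) - 2 * k) := by
      congr 1; push_cast; ring
    have f1 := cast_factorial_succ (n + k)
    have f2 := cast_factorial_add_two (n + k)
    have f5 := cast_factorial_succ k
    have f4 := cast_factorial_add_two (2 * k)
    simp only [expansionTerm, cubicCoeff_eq, one_mul, Int.cast_one, one_pow, mul_one]
    rw [(by ring : n + 1 + k = n + k + 1), (by ring : n + 2 + k = n + k + 2),
      (by ring : n + (k + 1) = n + k + 1), (by ring : 2 * (k + 1) = 2 * k + 2)]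
    push_cast at w0 w1 w2 f1 f2 f4 f5 ⊢
    rw [w2, w0, w1, f1, f2, f4, f5]
    field_simp
    ring

theorem cubicCoeff_recurrence_one_two (n : ℕ) :
    64 * ((n : ℚ) + 1) ^ 3 * expansionCoeff cubicCoeff (-1) 16 1 2 n
      + -2 * (2 * (n : ℚ) + 3) * (5 * ((n : ℚ) + 2) ^ 2 - 5 * ((n : ℚ) + 2) + 2)
        * expansionCoeff cubicCoeff (-1) 16 1 2 (n + 1)
      + ((n : ℚ) + 2) ^ 3 * expansionCoeff cubicCoeff (-1) 16 1 2 (n + 2) = 0 := by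
  refine expansionCoeff_recurrence one_pos (fun k => (k : ℚ) ^ 4 * (-9 * n - 15) *
    (((2 * k).factorial : ℚ) / (k.factorial : ℚ) ^ 5 * (-1) ^ k * ((n + 2 * k).factorial : ℚ)
      * expCoeff 16 ((n : ℤ) + 2 - k))) (by simp) ?_ fun k => ?_
  · rw [expCoeff_of_neg _ (by push_cast; omega)]; simp
  · have hk := (Nat.cast_ne_zero (R := ℚ)).2 k.factorial_ne_zero
    have hk1 : (k : ℚ) + 1 ≠ 0 := by positivity
    have hk3 := (Nat.cast_ne_zero (R := ℚ)).2 (3 * k).factorial_ne_zero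
    have w1 : expCoeff 16 ((n : ℤ) + 1 - k)
        = ((n : ℚ) + 2 - k) / 16 * expCoeff 16 ((n : ℤ) + 2 - k) := by
      rw [expCoeff_eq_succ (by norm_num)]; push_cast; ring_nf
    have w0 : expCoeff 16 ((n : ℤ) - k)
        = ((n : ℚ) + 1 - k) / 16 * expCoeff 16 ((n : ℤ) + 1 - k) := by
      rw [expCoeff_eq_succ (by norm_num)]; push_cast; ring_nf
    have w2 : expCoeff 16 ((n : ℤ) + 2 - (k + 1 : ℕ)) = expCoeff 16 ((n : ℤ) + 1 - k) := by
      congr 1; push_cast; ring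
    have f1 := cast_factorial_succ (n + 2 * k)
    have f2 := cast_factorial_add_two (n + 2 * k)
    have f5 := cast_factorial_succ k
    have f4 := cast_factorial_add_two (2 * k)
    simp only [expansionTerm, cubicCoeff_eq, Nat.cast_one, one_mul]
    rw [(by ring : n + 1 + 2 * k = n + 2 * k + 1), (by ring : n + 2 + 2 * k = n + 2 * k + 2),
      (by ring : n + 2 * (k + 1) = n + 2 * k + 2), (by ring : 2 * (k + 1) = 2 * k + 2)]
    push_cast at w0 w1 w2 f1 f2 f4 f5 ⊢
    rw [w2, w0, w1, f1, f2, f4, f5]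
    field_simp
    ring

/-- This is the recurrence of the Almkvist–Zudilin numbers 1, -3, 9, …; the method is that of the
cubic case. -/
theorem quarticCoeff_recurrence_three_one (n : ℕ) :
    81 * ((n : ℚ) + 1) ^ 3 * expansionCoeff quarticCoeff 1 (-3) 3 1 n
      + (2 * (n : ℚ) + 3) * (7 * ((n : ℚ) + 1) ^ 2 + 7 * ((n : ℚ) + 1) + 3)
        * expansionCoeff quarticCoeff 1 (-3) 3 1 (n + 1)
      + ((n : ℚ) + 2) ^ 3 * expansionCoeff quarticCoeff 1 (-3) 3 1 (n + 2) = 0 := by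
  refine expansionCoeff_recurrence three_pos (fun k => (k : ℚ) ^ 4 * (-144 * n - 180) *
    (1 / (k.factorial : ℚ) ^ 4 * ((n + k).factorial : ℚ)
      * expCoeff (-3) ((n : ℤ) + 2 - 3 * k))) (by simp) ?_ fun k => ?_
  · rw [expCoeff_of_neg _ (by push_cast; omega)]; simp
  · have hk := (Nat.cast_ne_zero (R := ℚ)).2 k.factorial_ne_zero
    have hk1 : (k : ℚ) + 1 ≠ 0 := by positivity
    have hk4 := (Nat.cast_ne_zero (R := ℚ)).2 (4 * k).factorial_ne_zero
    have w1 : expCoeff (-3) ((n : ℤ) + 1 - 3 * k)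
        = ((n : ℚ) + 2 - 3 * k) / (-3) * expCoeff (-3) ((n : ℤ) + 2 - 3 * k) := by
      rw [expCoeff_eq_succ (by norm_num)]; push_cast; ring_nf
    have w0 : expCoeff (-3) ((n : ℤ) - 3 * k)
        = ((n : ℚ) + 1 - 3 * k) / (-3) * expCoeff (-3) ((n : ℤ) + 1 - 3 * k) := by
      rw [expCoeff_eq_succ (by norm_num)]; push_cast; ring_nf
    have w2 : expCoeff (-3) ((n : ℤ) + 2 - 3 * (k + 1 : ℕ))
        = ((n : ℚ) - 3 * k) / (-3) * expCoeff (-3) ((n : ℤ) - 3 * k) := by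
      rw [expCoeff_eq_succ (by norm_num)]; push_cast; ring_nf
    have f1 := cast_factorial_succ (n + k)
    have f2 := cast_factorial_add_two (n + k)
    have f5 := cast_factorial_succ k
    simp only [expansionTerm, quarticCoeff_eq, one_mul, Int.cast_one, one_pow, mul_one]
    rw [(by ring : n + 1 + k = n + k + 1), (by ring : n + 2 + k = n + k + 2),
      (by ring : n + (k + 1) = n + k + 1)]
    push_cast at w0 w1 w2 f1 f2 f5 ⊢
    rw [w2, w0, w1, f1, f2, f5]
    field_simp
    ring

theorem quarticCoeff_recurrence_one_three (n : ℕ) :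
    81 * ((n : ℚ) + 1) ^ 3 * expansionCoeff quarticCoeff 1 (-27) 1 3 n
      + (2 * (n : ℚ) + 3) * (7 * ((n : ℚ) + 1) ^ 2 + 7 * ((n : ℚ) + 1) + 3)
        * expansionCoeff quarticCoeff 1 (-27) 1 3 (n + 1)
      + ((n : ℚ) + 2) ^ 3 * expansionCoeff quarticCoeff 1 (-27) 1 3 (n + 2) = 0 := by
  refine expansionCoeff_recurrence one_pos (fun k => (k : ℚ) ^ 4 * (-16 * n - 28) *
    (1 / (k.factorial : ℚ) ^ 4 * ((n + 3 * k).factorial : ℚ)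
      * expCoeff (-27) ((n : ℤ) + 2 - k))) (by simp) ?_ fun k => ?_
  · rw [expCoeff_of_neg _ (by push_cast; omega)]; simp
  · have hk := (Nat.cast_ne_zero (R := ℚ)).2 k.factorial_ne_zero
    have hk1 : (k : ℚ) + 1 ≠ 0 := by positivity
    have hk4 := (Nat.cast_ne_zero (R := ℚ)).2 (4 * k).factorial_ne_zero
    have w1 : expCoeff (-27) ((n : ℤ) + 1 - k)
        = ((n : ℚ) + 2 - k) / (-27) * expCoeff (-27) ((n : ℤ) + 2 - k) := by
      rw [expCoeff_eq_succ (by norm_num)]; push_cast; ring_nf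
    have w0 : expCoeff (-27) ((n : ℤ) - k)
        = ((n : ℚ) + 1 - k) / (-27) * expCoeff (-27) ((n : ℤ) + 1 - k) := by
      rw [expCoeff_eq_succ (by norm_num)]; push_cast; ring_nf
    have w2 : expCoeff (-27) ((n : ℤ) + 2 - (k + 1 : ℕ)) = expCoeff (-27) ((n : ℤ) + 1 - k) := by
      congr 1; push_cast; ring
    have f1 := cast_factorial_succ (n + 3 * k)
    have f2 := cast_factorial_add_two (n + 3 * k)
    have f3 := cast_factorial_add_three (n + 3 * k)
    have f5 := cast_factorial_succ k
    simp only [expansionTerm, quarticCoeff_eq, Nat.cast_one, one_mul, Int.cast_one, one_pow, mul_one]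
    rw [(by ring : n + 1 + 3 * k = n + 3 * k + 1), (by ring : n + 2 + 3 * k = n + 3 * k + 2),
      (by ring : n + 3 * (k + 1) = n + 3 * k + 3)]
    push_cast at w0 w1 w2 f1 f2 f3 f5 ⊢
    rw [w2, w0, w1, f1, f2, f3, f5]
    field_simp
    ring

theorem cubic_expansionCoeff_eq (n : ℕ) :
    expansionCoeff cubicCoeff 1 4 2 1 n = expansionCoeff cubicCoeff (-1) 16 1 2 n :=
  eq_of_recurrence (fun n => by positivity) cubicCoeff_recurrence_two_one
    cubicCoeff_recurrence_one_two (by decide) (by decide) n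

theorem quartic_expansionCoeff_eq (n : ℕ) :
    expansionCoeff quarticCoeff 1 (-3) 3 1 n = expansionCoeff quarticCoeff 1 (-27) 1 3 n :=
  eq_of_recurrence (fun n => by positivity) quarticCoeff_recurrence_three_one
    quarticCoeff_recurrence_one_three (by decide) (by decide) n

/-! ### Truncation modulo p -/

/-- Since M ≡ -b - 1, this is the usual formula for the binomial coefficient of a negative upper
argument. -/
theorem ZMod.choose_mul_neg_one_pow {p : ℕ} [Fact p.Prime] {b M : ℕ} (hp : p = b + M + 1) :
    ∀ j ≤ M, ((M.choose j : ℕ) : ZMod p) * (-1) ^ j = (((b + j).choose j : ℕ) : ZMod p)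
  | 0, _ => by simp
  | j + 1, hj => by
    have ih := ZMod.choose_mul_neg_one_pow hp j (by omega)
    have h1 := congrArg (Nat.cast (R := ZMod p)) (Nat.choose_succ_right_eq M j)
    have h2 := congrArg (Nat.cast (R := ZMod p)) (Nat.add_one_mul_choose_eq (b + j) j)
    have h3 : ((j + 1 : ℕ) : ZMod p) ≠ 0 := by
      rw [Ne, ZMod.natCast_eq_zero_iff]
      exact Nat.not_dvd_of_pos_of_lt (by omega) (by omega)
    have h4 : ((M - j : ℕ) : ZMod p) = -((b + j + 1 : ℕ) : ZMod p) := by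
      rw [eq_neg_iff_add_eq_zero, ← Nat.cast_add, ZMod.natCast_eq_zero_iff]
      exact ⟨1, by omega⟩
    refine mul_right_cancel₀ h3 ?_
    simp only [Nat.cast_mul] at h1 h2
    rw [← add_assoc, ← h2, ← ih, mul_right_comm, h1, h4, pow_succ]
    ring

/-- Modulo p the polynomial (1 - mX)^(p-1-B) is an initial segment of the series (1 - mX)^(-B-1).
The remaining N < p contribute nothing: for N < A the binomial vanishes, and at the upper end it is
divisible by p. -/
theorem ZMod.pow_mul_one_sub_pow {p : ℕ} [Fact p.Prime] {A B : ℕ} (hAB : A ≤ B) (hB : B < p)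
    (m u : ZMod p) :
    u ^ A * (1 - m * u) ^ (p - 1 - B)
      = ∑ N ∈ Finset.range p, ((N + (B - A)).choose B : ZMod p) * m ^ (N - A) * u ^ N := by
  obtain ⟨M, hM⟩ : ∃ M, p = B + M + 1 := ⟨p - 1 - B, by omega⟩
  obtain ⟨D, rfl⟩ := Nat.exists_eq_add_of_le hAB
  have e : Finset.range p = Finset.range (A + ((M + 1) + D)) := by congr 1; omega
  rw [e, Finset.sum_range_add, Finset.sum_range_add]
  have z1 : ∑ N ∈ Finset.range A, ((N + (A + D - A)).choose (A + D) : ZMod p) * m ^ (N - A) * u ^ N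
      = 0 := Finset.sum_eq_zero fun N hN => by
    rw [Nat.choose_eq_zero_of_lt (by have := Finset.mem_range.1 hN; omega)]; simp
  have z2 : ∑ N ∈ Finset.range D, ((A + (M + 1 + N) + (A + D - A)).choose (A + D) : ZMod p)
      * m ^ (A + (M + 1 + N) - A) * u ^ (A + (M + 1 + N)) = 0 := Finset.sum_eq_zero fun N hN => by
    have hN := Finset.mem_range.1 hN
    have e : A + (M + 1 + N) + (A + D - A) = (A + D) + (M + 1 + N) := by omega
    have : p ∣ ((A + D) + (M + 1 + N)).choose (A + D) :=
      (Fact.out : p.Prime).dvd_choose_add hB (by omega) (by omega)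
    rw [e, (ZMod.natCast_eq_zero_iff _ p).2 this]; simp
  rw [z1, z2, zero_add, add_zero, (by omega : p - 1 - (A + D) = M), sub_eq_neg_add, add_pow,
    Finset.mul_sum]
  refine Finset.sum_congr rfl fun j hj => ?_
  have hj := Finset.mem_range.1 hj
  have h := ZMod.choose_mul_neg_one_pow hM j (by omega)
  rw [(by omega : A + j + (A + D - A) = A + D + j), Nat.choose_symm_add, ← h,
    (by omega : A + j - A = j), one_pow, neg_pow, mul_pow, pow_add]
  ring

/-- After exchanging the sums, the inner sum over N is u^(ak) (1 - mu)^(p-1-(a+b)k), which Fermat's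
theorem identifies with t^k up to s^k. The exponent would be negative for (a+b)k ≥ p, and those k
drop out because p ∣ c k. -/
theorem ZMod.sum_eq_sum_expansionCoeff {p : ℕ} [Fact p.Prime] {c : ℕ → ℕ} {s m : ℤ} {a b : ℕ}
    (ha : 0 < a) (hc : ∀ k < p, p ≤ (a + b) * k → p ∣ c k) {u t : ZMod p} (hu : 1 - m * u ≠ 0)
    (ht : t * (1 - m * u) ^ (a + b) = s * u ^ a) :
    ∑ k ∈ Finset.range p, (c k : ZMod p) * t ^ k
      = ∑ N ∈ Finset.range p, (expansionCoeff c s m a b N : ZMod p) * u ^ N := by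
  have e : ∀ N ∈ Finset.range p, (expansionCoeff c s m a b N : ZMod p) * u ^ N
      = ∑ k ∈ Finset.range p, (c k : ZMod p) * (s : ZMod p) ^ k
        * (((N + b * k).choose ((a + b) * k) : ZMod p) * (m : ZMod p) ^ (N - a * k) * u ^ N) := by
    intro N hN
    unfold expansionCoeff
    push_cast
    rw [Finset.sum_mul]
    rw [Finset.sum_congr rfl fun k _ => (by ring : _ = (c k : ZMod p) * (s : ZMod p) ^ k
      * (((N + b * k).choose ((a + b) * k) : ZMod p) * (m : ZMod p) ^ (N - a * k) * u ^ N))]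
    refine Finset.sum_subset (Finset.range_mono (by have := Finset.mem_range.1 hN; omega))
      fun k _ hk => ?_
    have h1 : N < k := by simpa using hk
    have h2 : k ≤ a * k := Nat.le_mul_of_pos_left k ha
    rw [Nat.choose_eq_zero_of_lt (by rw [add_mul]; omega)]; simp
  rw [Finset.sum_congr rfl e, Finset.sum_comm]
  refine Finset.sum_congr rfl fun k hk => ?_
  have hk := Finset.mem_range.1 hk
  rw [← Finset.mul_sum]
  rcases le_or_gt p ((a + b) * k) with h | h
  · rw [(ZMod.natCast_eq_zero_iff _ p).2 (hc k hk h)]; simp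
  · have h1 := ZMod.pow_mul_one_sub_pow (A := a * k) (B := (a + b) * k)
      (by rw [add_mul]; omega) h (m : ZMod p) u
    rw [(by rw [add_mul]; omega : (a + b) * k - a * k = b * k)] at h1
    rw [← h1, mul_assoc]
    congr 1
    calc t ^ k = t ^ k * (1 - m * u) ^ (p - 1) := by rw [ZMod.pow_card_sub_one_eq_one hu, mul_one]
      _ = (t * (1 - m * u) ^ (a + b)) ^ k * (1 - m * u) ^ (p - 1 - (a + b) * k) := by
        rw [mul_pow, ← pow_mul, mul_assoc, ← pow_add]; congr 2; omega
      _ = _ := by rw [ht, mul_pow, ← pow_mul]; ring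

theorem factorial_mul_cubicCoeff (k : ℕ) :
    k.factorial ^ 5 * cubicCoeff k = (2 * k).factorial * (3 * k).factorial := by
  have h := cubicCoeff_eq k
  have := (Nat.cast_ne_zero (R := ℚ)).2 k.factorial_ne_zero
  field_simp at h
  rw [mul_comm]
  exact_mod_cast h

theorem factorial_mul_quarticCoeff (k : ℕ) :
    k.factorial ^ 4 * quarticCoeff k = (4 * k).factorial := by
  have h := quarticCoeff_eq k
  have := (Nat.cast_ne_zero (R := ℚ)).2 k.factorial_ne_zero
  field_simp at h
  rw [mul_comm]
  exact_mod_cast h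

theorem Nat.Prime.dvd_cubicCoeff {p : ℕ} (hp : p.Prime) {k : ℕ} (hk : k < p) (h : p ≤ 3 * k) :
    p ∣ cubicCoeff k := by
  have h1 : p ∣ k.factorial ^ 5 * cubicCoeff k := by
    rw [factorial_mul_cubicCoeff]
    exact (hp.dvd_factorial.2 h).mul_left _
  exact (hp.dvd_mul.1 h1).resolve_left fun h2 =>
    absurd (hp.dvd_factorial.1 (hp.dvd_of_dvd_pow h2)) (by omega)

theorem Nat.Prime.dvd_quarticCoeff_iff {p : ℕ} (hp : p.Prime) {k : ℕ} (hk : k < p) :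
    p ∣ quarticCoeff k ↔ p ≤ 4 * k := by
  rw [← hp.dvd_factorial, ← factorial_mul_quarticCoeff, hp.dvd_mul, or_iff_right]
  exact fun h2 => absurd (hp.dvd_factorial.1 (hp.dvd_of_dvd_pow h2)) (by omega)

theorem ZMod.cubic_sum_eq {p : ℕ} [Fact p.Prime] {u t t' : ZMod p} (h : 1 - 4 * u ≠ 0)
    (h' : 1 - 16 * u ≠ 0) (ht : t * (1 - 4 * u) ^ 3 = u ^ 2) (ht' : t' * (1 - 16 * u) ^ 3 = -u) :
    ∑ k ∈ Finset.range p, (cubicCoeff k : ZMod p) * t ^ k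
      = ∑ k ∈ Finset.range p, (cubicCoeff k : ZMod p) * t' ^ k := by
  have hc : ∀ k < p, p ≤ 3 * k → p ∣ cubicCoeff k := fun k => Nat.Prime.dvd_cubicCoeff Fact.out
  rw [ZMod.sum_eq_sum_expansionCoeff (s := 1) (m := 4) (a := 2) (b := 1) (u := u) two_pos hc
    (by simpa using h) (by simpa using ht),
    ZMod.sum_eq_sum_expansionCoeff (s := -1) (m := 16) (a := 1) (b := 2) (u := u) one_pos hc
    (by simpa using h') (by simpa using ht')]
  simp only [cubic_expansionCoeff_eq]

theorem ZMod.quartic_sum_eq {p : ℕ} [Fact p.Prime] {u t t' : ZMod p} (h : 1 + 3 * u ≠ 0)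
    (h' : 1 + 27 * u ≠ 0) (ht : t * (1 + 3 * u) ^ 4 = u ^ 3) (ht' : t' * (1 + 27 * u) ^ 4 = u) :
    ∑ k ∈ Finset.range p, (quarticCoeff k : ZMod p) * t ^ k
      = ∑ k ∈ Finset.range p, (quarticCoeff k : ZMod p) * t' ^ k := by
  have hc : ∀ k < p, p ≤ 4 * k → p ∣ quarticCoeff k := fun k hk =>
    (Nat.Prime.dvd_quarticCoeff_iff Fact.out hk).2
  rw [ZMod.sum_eq_sum_expansionCoeff (s := 1) (m := -3) (a := 3) (b := 1) (u := u) three_pos hc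
    (by simpa using h) (by simpa using ht),
    ZMod.sum_eq_sum_expansionCoeff (s := 1) (m := -27) (a := 1) (b := 3) (u := u) one_pos hc
    (by simpa using h') (by simpa using ht')]
  simp only [quartic_expansionCoeff_eq]

/-! ### The third order operator and its first integral -/

open Polynomial in
/-- The third order differential operator annihilating `∑ c k * X ^ k` whenever
`(k + 1) ^ 3 * c (k + 1) = (2 * k + 1) * (h * k * (k + 1) + d) * c k`. -/
noncomputable def clausenOp {R : Type*} [CommRing R] (h d : ℕ) (y : R[X]) : R[X] :=
  X ^ 2 * (1 - 2 * (h : R[X]) * X) * derivative (derivative (derivative y))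
    + 3 * X * (1 - 3 * (h : R[X]) * X) * derivative (derivative y)
    + (1 - (6 * (h : R[X]) + 2 * (d : R[X])) * X) * derivative y - (d : R[X]) * y

open Polynomial in
/-- The quadratic first integral of `clausenOp`. It vanishes on squares of solutions of the
second order equation of which `clausenOp` is the symmetric square. -/
noncomputable def clausenIntegral {R : Type*} [CommRing R] (h d : ℕ) (y : R[X]) : R[X] :=
  X ^ 2 * (1 - 2 * (h : R[X]) * X) * (2 * y * derivative (derivative y) - derivative y ^ 2)
    + 2 * X * (1 - 3 * (h : R[X]) * X) * y * derivative y - 2 * (d : R[X]) * X * y ^ 2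

/-- The polynomial `∑_{k < p} c k * X ^ k`. -/
noncomputable def truncSeries (c : ℕ → ℕ) (p : ℕ) : Polynomial ℤ :=
  ∑ k ∈ Finset.range p, (c k : Polynomial ℤ) * Polynomial.X ^ k

namespace Polynomial

variable {R : Type*} [CommRing R]

theorem derivative_clausenIntegral (h d : ℕ) (y : R[X]) :
    derivative (clausenIntegral h d y) = 2 * y * clausenOp h d y := by
  simp only [clausenIntegral, clausenOp, derivative_mul, derivative_add, derivative_sub,
    derivative_X, derivative_one, derivative_natCast, derivative_ofNat,
    derivative_pow, C_ofNat, Nat.cast_ofNat]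
  ring

theorem X_mul_derivative_X_pow (k : ℕ) : X * derivative (X ^ k : R[X]) = (k : R[X]) * X ^ k := by
  cases k with
  | zero => simp
  | succ k => rw [derivative_X_pow]; simp; ring

theorem X_mul_clausenOp_X_pow (h d k : ℕ) : X * clausenOp h d (X ^ k : R[X])
    = (k : R[X]) ^ 3 * X ^ k - (2 * (k : R[X]) + 1) * ((h : R[X]) * (k : R[X]) * ((k : R[X]) + 1) + (d : R[X])) * X ^ (k + 1) := by
  have h1 := X_mul_derivative_X_pow (R := R) k
  have h2 := congrArg derivative h1
  have h3 := congrArg derivative h2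
  simp only [derivative_mul, derivative_add, derivative_X, derivative_natCast, derivative_one,
    map_zero] at h2 h3
  simp only [clausenOp]
  linear_combination (X ^ 2 * (1 - 2 * (h : R[X]) * X)) * h3
    + (X * ((k : R[X]) - 2) * (1 - 2 * (h : R[X]) * X) + 3 * X * (1 - 3 * (h : R[X]) * X)) * h2
    + (((k : R[X]) - 2) * ((k : R[X]) - 1) * (1 - 2 * (h : R[X]) * X)
      + 3 * ((k : R[X]) - 1) * (1 - 3 * (h : R[X]) * X)
      + (1 - (6 * (h : R[X]) + 2 * (d : R[X])) * X)) * h1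

theorem clausenOp_sum {ι : Type*} (h d : ℕ) (s : Finset ι) (f : ι → R[X]) :
    clausenOp h d (∑ i ∈ s, f i) = ∑ i ∈ s, clausenOp h d (f i) := by
  simp only [clausenOp, derivative_sum, Finset.mul_sum, Finset.sum_add_distrib,
    Finset.sum_sub_distrib]

theorem clausenOp_natCast_mul (h d n : ℕ) (y : R[X]) :
    clausenOp h d ((n : R[X]) * y) = (n : R[X]) * clausenOp h d y := by
  simp only [clausenOp, derivative_mul, derivative_natCast, zero_mul, zero_add]
  ring

theorem clausenOp_map {S : Type*} [CommRing S] (f : R →+* S) (h d : ℕ) (y : R[X]) :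
    (clausenOp h d y).map f = clausenOp h d (y.map f) := by
  simp [clausenOp, derivative_map]

theorem clausenIntegral_map {S : Type*} [CommRing S] (f : R →+* S) (h d : ℕ) (y : R[X]) :
    (clausenIntegral h d y).map f = clausenIntegral h d (y.map f) := by
  simp [clausenIntegral, derivative_map]

/-- The recurrence for c makes the images of the monomials telescope, leaving only the boundary term
at k = p, which carries the factor p³. -/
theorem X_mul_clausenOp_truncSeries {c : ℕ → ℕ} {h d : ℕ}
    (hc : ∀ k, (k + 1) ^ 3 * c (k + 1) = (2 * k + 1) * (h * k * (k + 1) + d) * c k) (p : ℕ) :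
    X * clausenOp h d (truncSeries c p) = -((p : ℤ[X]) ^ 3 * (c p : ℤ[X]) * X ^ p) := by
  rw [truncSeries, clausenOp_sum, Finset.mul_sum]
  have e : ∀ k ∈ Finset.range p, X * clausenOp h d ((c k : ℤ[X]) * X ^ k)
      = (k : ℤ[X]) ^ 3 * (c k : ℤ[X]) * X ^ k
        - ((k + 1 : ℕ) : ℤ[X]) ^ 3 * (c (k + 1) : ℤ[X]) * X ^ (k + 1) := by
    intro k _
    have h1 := congrArg (Nat.cast (R := ℤ[X])) (hc k)
    rw [clausenOp_natCast_mul, mul_left_comm, X_mul_clausenOp_X_pow]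
    push_cast at h1 ⊢
    linear_combination X ^ (k + 1) * h1
  rw [Finset.sum_congr rfl e, Finset.sum_range_sub']
  simp

theorem natDegree_truncSeries_le (c : ℕ → ℕ) (p : ℕ) : (truncSeries c p).natDegree ≤ p - 1 := by
  refine natDegree_sum_le_of_forall_le _ _ fun k hk => ?_
  have := Finset.mem_range.1 hk
  have h1 : ((c k : ℤ[X]) * X ^ k).natDegree ≤ k := by compute_degree
  omega

theorem natDegree_clausenIntegral_le (h d : ℕ) {y : R[X]} {n : ℕ} (hy : y.natDegree ≤ n) :
    (clausenIntegral h d y).natDegree ≤ 2 * n + 3 := by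
  have h1 : (derivative y).natDegree ≤ n := (natDegree_derivative_le y).trans (by omega)
  have h2 : (derivative (derivative y)).natDegree ≤ n :=
    (natDegree_derivative_le _).trans (by omega)
  unfold clausenIntegral
  have a1 : (1 - 2 * (h : R[X]) * X).natDegree ≤ 1 := by compute_degree
  have a2 : (1 - 3 * (h : R[X]) * X).natDegree ≤ 1 := by compute_degree
  have a3 : (2 * y).natDegree ≤ n := (natDegree_mul_le_of_le (by compute_degree) hy).trans
    (by omega : 0 + n ≤ n)
  have b1 := natDegree_sub_le_of_le (natDegree_mul_le_of_le a3 h2) (natDegree_pow_le_of_le 2 h1)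
  have b2 : (X ^ 2 : R[X]).natDegree ≤ 2 := by compute_degree
  have b3 : (2 * X : R[X]).natDegree ≤ 1 := by compute_degree
  have b4 : (2 * (d : R[X]) * X : R[X]).natDegree ≤ 1 := by compute_degree
  have c1 := natDegree_mul_le_of_le (natDegree_mul_le_of_le b2 a1) b1
  have c2 := natDegree_mul_le_of_le (natDegree_mul_le_of_le (natDegree_mul_le_of_le b3 a2) hy) h1
  have c3 := natDegree_mul_le_of_le b4 (natDegree_pow_le_of_le 2 hy)
  refine (natDegree_sub_le_of_le (natDegree_add_le_of_le c1 c2) c3).trans ?_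
  simp only [max_le_iff]
  omega

/-- The derivative of the first integral J is 2y times the operator applied to y, so p³ divides
every coefficient of XJ'. Integrating divides the coefficient of X^n by n ≤ 2p + 1 < p², which costs
at most one factor p, and the constant term of J is zero. -/
theorem dvd_clausenIntegral_truncSeries {p : ℕ} (hp : p.Prime) (hodd : Odd p) {c : ℕ → ℕ}
    {h d : ℕ} (hc : ∀ k, (k + 1) ^ 3 * c (k + 1) = (2 * k + 1) * (h * k * (k + 1) + d) * c k) :
    C ((p : ℤ) ^ 2) ∣ clausenIntegral h d (truncSeries c p) := by
  rw [C_dvd_iff_dvd_coeff]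
  intro i
  set J := clausenIntegral h d (truncSeries c p) with hJ
  have hp3 : 3 ≤ p := by have := hp.two_le; rcases hodd with ⟨k, rfl⟩; omega
  rcases lt_or_ge (2 * (p - 1) + 3) i with hi | hi
  · rw [coeff_eq_zero_of_natDegree_lt (lt_of_le_of_lt
      (natDegree_clausenIntegral_le h d (natDegree_truncSeries_le c p)) hi)]
    exact dvd_zero _
  cases i with
  | zero => simp [hJ, clausenIntegral, coeff_zero_eq_eval_zero]
  | succ i =>
  have h1 : X * derivative J = C ((p : ℤ) ^ 3) * (-(2 * truncSeries c p * ((c p : ℤ[X]) * X ^ p))) := by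
    rw [hJ, derivative_clausenIntegral, mul_left_comm, X_mul_clausenOp_truncSeries hc]
    simp only [map_pow, map_natCast]
    ring
  have h2 : (p : ℤ) ^ 3 ∣ J.coeff (i + 1) * ((i : ℤ) + 1) := by
    rw [← coeff_derivative, ← coeff_X_mul, h1, coeff_C_mul]
    exact dvd_mul_right _ _
  have hpz : Prime (p : ℤ) := Nat.prime_iff_prime_int.1 hp
  have h3 : ¬ (p : ℤ) ^ 2 ∣ (i : ℤ) + 1 := by
    intro h4
    have := Int.le_of_dvd (by omega) h4
    zify at hi hp3
    rw [Nat.cast_sub (by omega)] at hi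
    push_cast at hi
    nlinarith
  by_cases h4 : (p : ℤ) ∣ (i : ℤ) + 1
  · obtain ⟨m, hm⟩ := h4
    rw [hm, mul_left_comm, pow_succ', mul_dvd_mul_iff_left hpz.ne_zero] at h2
    refine hpz.pow_dvd_of_dvd_mul_right 2 (fun h5 => h3 ?_) h2
    rw [hm, sq]
    exact mul_dvd_mul_left _ h5
  · exact (pow_dvd_pow _ (by norm_num)).trans (hpz.pow_dvd_of_dvd_mul_right 3 h4 h2)

end Polynomial

/-! ### Multiplicities of zeros of solutions in characteristic p -/

namespace Polynomial

variable {K : Type*} [Field K] {p : ℕ} [CharP K p]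

theorem natCast_ne_zero_of_pos_of_lt {n : ℕ} (h0 : 0 < n) (hn : n < p) : (n : K) ≠ 0 := by
  rw [Ne, CharP.cast_eq_zero_iff K p]
  exact Nat.not_dvd_of_pos_of_lt h0 hn

theorem derivative_X_sub_C_pow_succ_mul {R : Type*} [CommRing R] (r : R) (n : ℕ) (z : R[X]) :
    derivative ((X - C r) ^ (n + 1) * z)
      = (X - C r) ^ n * (((n : R[X]) + 1) * z + (X - C r) * derivative z) := by
  rw [derivative_mul, derivative_X_sub_C_pow, Nat.add_sub_cancel]
  simp only [Nat.cast_add, Nat.cast_one, map_add, map_natCast, map_one]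
  ring

theorem rootMultiplicity_le_natDegree (y : K[X]) (r : K) :
    y.rootMultiplicity r ≤ y.natDegree := by
  classical
  rw [← count_roots]
  exact (Multiset.count_le_card _ _).trans (card_roots' y)

theorem exists_eq_X_sub_C_pow_mul {y : K[X]} (hy : y ≠ 0) (r : K) :
    ∃ z : K[X], y = (X - C r) ^ y.rootMultiplicity r * z ∧ z.eval r ≠ 0 := by
  obtain ⟨z, hz, hz'⟩ := y.exists_eq_pow_rootMultiplicity_mul_and_not_dvd hy r
  exact ⟨z, hz, fun h => hz' (dvd_iff_isRoot.2 h)⟩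

/-- The local exponents at a nonsingular point are 0, 1, 2: for y = (X - r)^m z the leading
coefficient is r²(1 - 2hr) m(m-1)(m-2) z(r), nonzero for 3 ≤ m < p. -/
theorem rootMultiplicity_lt_three_of_clausenOp_eq_zero {h d : ℕ} {y : K[X]} (hy : y ≠ 0)
    (hdeg : y.natDegree < p) (hL : clausenOp h d y = 0) {r : K} (hr : r ≠ 0)
    (hr' : 1 - 2 * h * r ≠ 0) : y.rootMultiplicity r < 3 := by
  by_contra! hm
  obtain ⟨z, hz, hz0⟩ := exists_eq_X_sub_C_pow_mul hy r
  obtain ⟨k, hk⟩ := Nat.exists_eq_add_of_le' hm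
  have hlt : k + 3 < p := by
    rw [← hk]
    exact (rootMultiplicity_le_natDegree y r).trans_lt hdeg
  rw [hk] at hz
  obtain ⟨w, hw⟩ : ∃ w, w = X - C r := ⟨_, rfl⟩
  have h1 := derivative_X_sub_C_pow_succ_mul r (k + 2) z
  rw [← hz, ← hw] at h1
  obtain ⟨z1, hz1⟩ : ∃ z1, z1 = (((k + 2 : ℕ) : K[X]) + 1) * z + w * derivative z := ⟨_, rfl⟩
  rw [← hz1] at h1
  have h2 := derivative_X_sub_C_pow_succ_mul r (k + 1) z1
  rw [← hw, ← h1] at h2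
  obtain ⟨z2, hz2⟩ : ∃ z2, z2 = (((k + 1 : ℕ) : K[X]) + 1) * z1 + w * derivative z1 := ⟨_, rfl⟩
  rw [← hz2] at h2
  have h3 := derivative_X_sub_C_pow_succ_mul r k z2
  rw [← hw, ← h2] at h3
  rw [clausenOp, h3, h2, h1, hz, ← hw] at hL
  have hL' : w ^ k * (X ^ 2 * (1 - 2 * (h : K[X]) * X) * (((k : K[X]) + 1) * z2 + w * derivative z2)
      + w * (3 * X * (1 - 3 * (h : K[X]) * X) * z2
        + (1 - (6 * (h : K[X]) + 2 * (d : K[X])) * X) * w * z1 - (d : K[X]) * w ^ 2 * z)) = 0 := by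
    rw [← hL]; ring
  have hw0 : w ^ k ≠ 0 := by rw [hw]; exact pow_ne_zero _ (X_sub_C_ne_zero r)
  have h4 := congrArg (eval r) ((mul_eq_zero.1 hL').resolve_left hw0)
  have hwr : w.eval r = 0 := by rw [hw]; simp
  simp only [hz2, hz1, eval_add, eval_mul, eval_sub, eval_pow, eval_X, eval_natCast, eval_one, eval_ofNat,
    hwr, zero_mul, add_zero, eval_zero] at h4
  have n1 : ((k : K) + 1) ≠ 0 := by
    exact_mod_cast natCast_ne_zero_of_pos_of_lt (K := K) (p := p) (n := k + 1) (by omega) (by omega)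
  have n2 : (((k + 1 : ℕ) : K) + 1) ≠ 0 := by
    exact_mod_cast natCast_ne_zero_of_pos_of_lt (K := K) (p := p) (n := k + 1 + 1) (by omega)
      (by omega)
  have n3 : (((k + 2 : ℕ) : K) + 1) ≠ 0 := by
    exact_mod_cast natCast_ne_zero_of_pos_of_lt (K := K) (p := p) (n := k + 2 + 1) (by omega)
      (by omega)
  exact mul_ne_zero (mul_ne_zero (pow_ne_zero 2 hr) hr') (mul_ne_zero n1 (mul_ne_zero n2
    (mul_ne_zero n3 hz0))) h4

/-- At the singular point r = 1/(2h) the local exponents are 0, 1/2, 1, with indicial polynomial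
proportional to m(m-1)(2m-1). The degree bound gives 2m - 1 < p, which excludes m = (p+1)/2, the
residue of 1/2. -/
theorem rootMultiplicity_lt_two_of_clausenOp_eq_zero {h d : ℕ} {y : K[X]} (hy : y ≠ 0)
    (hdeg : 2 * y.natDegree < p + 1) (hL : clausenOp h d y = 0) {r : K}
    (hr : 1 - 2 * h * r = 0) : y.rootMultiplicity r < 2 := by
  by_contra! hm
  obtain ⟨z, hz, hz0⟩ := exists_eq_X_sub_C_pow_mul hy r
  obtain ⟨k, hk⟩ := Nat.exists_eq_add_of_le' hm
  have hlt : 2 * (k + 2) < p + 1 := by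
    rw [← hk]
    have := rootMultiplicity_le_natDegree y r
    omega
  rw [hk] at hz
  obtain ⟨w, hw⟩ : ∃ w, w = X - C r := ⟨_, rfl⟩
  have h1 := derivative_X_sub_C_pow_succ_mul r (k + 1) z
  rw [← hz, ← hw] at h1
  obtain ⟨z1, hz1⟩ : ∃ z1, z1 = (((k + 1 : ℕ) : K[X]) + 1) * z + w * derivative z := ⟨_, rfl⟩
  rw [← hz1] at h1
  have h2 := derivative_X_sub_C_pow_succ_mul r k z1
  rw [← hw, ← h1] at h2
  obtain ⟨z2, hz2⟩ : ∃ z2, z2 = ((k : K[X]) + 1) * z1 + w * derivative z1 := ⟨_, rfl⟩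
  rw [← hz2] at h2
  -- The extra factor w, supplied later by 1 - 2hX = -2hw, avoids the exponent k - 1 when k = 0.
  have h3 : w * derivative (derivative (derivative y)) = w ^ k * ((k : K[X]) * z2 + w * derivative z2) := by
    have h5 := derivative_X_sub_C_pow_succ_mul r k z2
    have h6 : (X - C r) ^ (k + 1) * z2 = w * derivative (derivative y) := by rw [h2, hw]; ring
    have hw1 : derivative w = 1 := by rw [hw]; simp
    rw [h6, derivative_mul, hw1, h2, ← hw] at h5
    rw [h2]
    linear_combination h5
  have e1 : (1 - 2 * (h : K[X]) * X) = -2 * (h : K[X]) * w := by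
    have := congrArg C hr
    simp only [map_sub, map_mul, map_one, map_zero, map_natCast, map_ofNat] at this
    rw [hw]
    linear_combination this
  have hL' : w ^ k * (X ^ 2 * (-2 * (h : K[X])) * ((k : K[X]) * z2 + w * derivative z2)
      + 3 * X * (1 - 3 * (h : K[X]) * X) * z2
      + w * ((1 - (6 * (h : K[X]) + 2 * (d : K[X])) * X) * z1 - (d : K[X]) * w * z)) = 0 := by
    rw [clausenOp, e1, h2, h1] at hL
    rw [← hL]
    have hzw : y = w ^ (k + 2) * z := by rw [hw]; exact hz
    rw [h2] at h3
    conv_rhs => rw [hzw]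
    linear_combination (-(X ^ 2 * (-2 * (h : K[X])))) * h3
  have hw0 : w ^ k ≠ 0 := by rw [hw]; exact pow_ne_zero _ (X_sub_C_ne_zero r)
  have h4 := congrArg (eval r) ((mul_eq_zero.1 hL').resolve_left hw0)
  have hwr : w.eval r = 0 := by rw [hw]; simp
  simp only [hz2, hz1, eval_add, eval_mul, eval_sub, eval_pow, eval_X, eval_natCast, eval_one,
    eval_ofNat, eval_neg, hwr, zero_mul, add_zero, eval_zero] at h4
  have n1 : ((k : K) + 1) ≠ 0 := by
    exact_mod_cast natCast_ne_zero_of_pos_of_lt (K := K) (p := p) (n := k + 1) (by omega) (by omega)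
  have n2 : (((k + 1 : ℕ) : K) + 1) ≠ 0 := by
    exact_mod_cast natCast_ne_zero_of_pos_of_lt (K := K) (p := p) (n := k + 1 + 1) (by omega)
      (by omega)
  have n3 : (2 * (k : K) + 3) ≠ 0 := by
    exact_mod_cast natCast_ne_zero_of_pos_of_lt (K := K) (p := p) (n := 2 * k + 3) (by omega)
      (by omega)
  have hr0 : r ≠ 0 := by rintro rfl; simp at hr
  refine mul_ne_zero (mul_ne_zero hr0 n3) (mul_ne_zero n1 (mul_ne_zero n2 hz0)) ?_
  linear_combination -2 * h4
    + (2 * k + 9) * r * (k + 1) * (((k + 1 : ℕ) : K) + 1) * eval r z * hr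

/-- The zero r is simple. At any other zero s the first integral reduces to -s²(1 - 2hs) y'(s)², so
s is a multiple zero, hence exactly double. Over an algebraically closed field the degree is
therefore 1 plus an even number. -/
theorem odd_natDegree_of_clausenIntegral_eq_zero [IsAlgClosed K] {h d : ℕ} {y : K[X]}
    (h0 : y.eval 0 ≠ 0) (hdeg : 2 * y.natDegree < p + 1) (hp : 3 ≤ p)
    (hL : clausenOp h d y = 0) (hJ : clausenIntegral h d y = 0) {r : K}
    (hr : 1 - 2 * h * r = 0) (hyr : y.eval r = 0) : Odd y.natDegree := by
  classical
  have hy : y ≠ 0 := by rintro rfl; simp at h0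
  have hr1 : y.roots.count r = 1 := by
    rw [count_roots]
    have h1 := rootMultiplicity_lt_two_of_clausenOp_eq_zero hy hdeg hL hr
    have h2 := (rootMultiplicity_pos hy).2 hyr
    omega
  have hs : ∀ s ∈ y.roots.toFinset.erase r, y.roots.count s = 2 := by
    intro s hs
    obtain ⟨hsr, hs⟩ := Finset.mem_erase.1 hs
    have hs : y.eval s = 0 := by simpa [hy] using hs
    have hs0 : s ≠ 0 := by rintro rfl; exact h0 hs
    have hs1 : 1 - 2 * (h : K) * s ≠ 0 := by
      intro h1
      have h2 : 2 * (h : K) * (s - r) = 0 := by linear_combination hr - h1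
      rcases mul_eq_zero.1 h2 with h3 | h3
      · rw [h3] at hr; simp at hr
      · exact hsr (sub_eq_zero.1 h3)
    have h1 := rootMultiplicity_lt_three_of_clausenOp_eq_zero hy (by omega) hL hs0 hs1
    have h2 : (derivative y).eval s = 0 := by
      have := congrArg (eval s) hJ
      simp only [clausenIntegral, eval_add, eval_mul, eval_sub, eval_pow, eval_X, eval_natCast,
        eval_one, eval_ofNat, hs, eval_zero] at this
      by_contra h3
      refine mul_ne_zero (mul_ne_zero (pow_ne_zero 2 hs0) hs1) (pow_ne_zero 2 h3) ?_
      linear_combination -this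
    have h3 := (one_lt_rootMultiplicity_iff_isRoot hy).2 ⟨hs, h2⟩
    rw [count_roots]
    omega
  rw [← splits_iff_card_roots.1 (IsAlgClosed.splits y), ← Multiset.toFinset_sum_count_eq,
    ← Finset.add_sum_erase _ _ (by simpa [hy] using hyr : r ∈ y.roots.toFinset), hr1,
    Finset.sum_congr rfl hs, Finset.sum_const, smul_eq_mul]
  exact ⟨(y.roots.toFinset.erase r).card, by ring⟩

end Polynomial

/-! ### Lifting a zero from p to p² -/

namespace Polynomial

theorem two_lt_rootMultiplicity_of_eval_eq_zero {K : Type*} [Field K] (h2 : (2 : K) ≠ 0)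
    {y : K[X]} (hy : y ≠ 0) {r : K} (h0 : y.eval r = 0) (h1 : (derivative y).eval r = 0)
    (h3 : (derivative (derivative y)).eval r = 0) : 2 < y.rootMultiplicity r := by
  have h4 := (one_lt_rootMultiplicity_iff_isRoot hy).2 ⟨h0, h1⟩
  by_contra! h5
  obtain ⟨z, hz, hz0⟩ := exists_eq_X_sub_C_pow_mul hy r
  rw [(by omega : y.rootMultiplicity r = 2)] at hz
  rw [hz] at h3
  simp only [pow_two, derivative_mul, derivative_sub, derivative_X, derivative_C, derivative_add,
    eval_add, eval_mul, eval_sub, eval_X, eval_C, eval_one, eval_zero, derivative_one, sub_self,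
    derivative_zero] at h3
  exact mul_ne_zero h2 hz0 (by linear_combination h3)

/-- The reduction of `truncSeries` to a commutative ring. -/
noncomputable abbrev truncSeriesMap (R : Type*) [CommRing R] (c : ℕ → ℕ) (p : ℕ) : R[X] :=
  (truncSeries c p).map (Int.castRingHom R)

theorem truncSeriesMap_eq (R : Type*) [CommRing R] (c : ℕ → ℕ) (p : ℕ) :
    truncSeriesMap R c p = ∑ k ∈ Finset.range p, (c k : R[X]) * X ^ k := by
  simp [truncSeriesMap, truncSeries, Polynomial.map_sum]

theorem coeff_truncSeriesMap (R : Type*) [CommRing R] (c : ℕ → ℕ) {p k : ℕ} (hk : k < p) :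
    (truncSeriesMap R c p).coeff k = c k := by
  rw [truncSeriesMap_eq, finsetSum_coeff, Finset.sum_eq_single k]
  · rw [← C_eq_natCast, coeff_C_mul_X_pow, if_pos rfl]
  · intro j _ hj
    rw [← C_eq_natCast, coeff_C_mul_X_pow, if_neg hj.symm]
  · exact fun h => absurd (Finset.mem_range.2 hk) h

theorem eval_zero_truncSeriesMap (R : Type*) [CommRing R] {c : ℕ → ℕ} {p : ℕ}
    (hp : 0 < p) (h0 : c 0 = 1) :
    (truncSeriesMap R c p).eval 0 = 1 := by
  rw [← coeff_zero_eq_eval_zero, coeff_truncSeriesMap R c hp, h0, Nat.cast_one]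

section CharP

variable {K : Type*} [Field K] {p : ℕ} [CharP K p] {c : ℕ → ℕ} {h d : ℕ}

theorem natDegree_truncSeriesMap_le {n : ℕ} (hdeg : ∀ k < p, n < k → p ∣ c k) :
    (truncSeriesMap K c p).natDegree ≤ n := by
  rw [truncSeriesMap_eq]
  refine natDegree_sum_le_of_forall_le _ _ fun k hk => ?_
  rcases le_or_gt k n with hkn | hkn
  · have h1 : ((c k : K[X]) * X ^ k).natDegree ≤ k := by compute_degree
    exact h1.trans hkn
  · rw [← C_eq_natCast, (CharP.cast_eq_zero_iff K p _).2 (hdeg k (Finset.mem_range.1 hk) hkn)]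
    simp

theorem clausenOp_truncSeriesMap
    (hc : ∀ k, (k + 1) ^ 3 * c (k + 1) = (2 * k + 1) * (h * k * (k + 1) + d) * c k) :
    clausenOp h d (truncSeriesMap K c p) = 0 := by
  have h1 := congrArg (map (Int.castRingHom K)) (X_mul_clausenOp_truncSeries hc p)
  rw [Polynomial.map_mul, clausenOp_map, map_X] at h1
  refine (mul_eq_zero.1 (h1.trans ?_)).resolve_left X_ne_zero
  simp

theorem clausenIntegral_truncSeriesMap (hp : p.Prime) (hodd : Odd p)
    (hc : ∀ k, (k + 1) ^ 3 * c (k + 1) = (2 * k + 1) * (h * k * (k + 1) + d) * c k) :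
    clausenIntegral h d (truncSeriesMap K c p) = 0 := by
  obtain ⟨Q, hQ⟩ := dvd_clausenIntegral_truncSeries hp hodd hc
  rw [truncSeriesMap, ← clausenIntegral_map, hQ]
  simp

end CharP

theorem eval_intCast_map_eq_zero_iff {p : ℕ} (f : ℤ[X]) (T : ℤ) :
    (f.map (Int.castRingHom (ZMod p))).eval (T : ZMod p) = 0 ↔ (p : ℤ) ∣ f.eval T := by
  rw [eval_intCast_map, eq_intCast, ZMod.intCast_zmod_eq_zero_iff_dvd, Int.cast_id]

/-- A truncated solution of a symmetric square equation which vanishes modulo `p` vanishes modulo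
`p ^ 2`, unless the argument is a simple zero of the discriminant modulo `p`. -/
theorem sq_dvd_eval_truncSeries {p : ℕ} (hp : p.Prime) (hodd : Odd p) {c : ℕ → ℕ} {h d : ℕ}
    (hc : ∀ k, (k + 1) ^ 3 * c (k + 1) = (2 * k + 1) * (h * k * (k + 1) + d) * c k)
    (h0 : c 0 = 1) (hdeg : ∀ k < p, p / 2 < k → p ∣ c k) {T : ℤ}
    (hT : (p : ℤ) ∣ (truncSeries c p).eval T)
    (hdisc : (p : ℤ) ∣ 1 - 2 * h * T → (p : ℤ) ^ 2 ∣ 1 - 2 * h * T) :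
    (p : ℤ) ^ 2 ∣ (truncSeries c p).eval T := by
  have : Fact p.Prime := ⟨hp⟩
  have hpz : Prime (p : ℤ) := Nat.prime_iff_prime_int.1 hp
  have hp3 : 3 ≤ p := by have := hp.two_le; rcases hodd with ⟨k, rfl⟩; omega
  set S := truncSeries c p with hS
  set y := truncSeriesMap (ZMod p) c p with hy
  have hy0 : y.eval 0 = 1 := eval_zero_truncSeriesMap _ hp.pos h0
  have hyne : y ≠ 0 := by rintro h; rw [h] at hy0; simp at hy0
  have hydeg : y.natDegree ≤ p / 2 := natDegree_truncSeriesMap_le hdeg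
  have hyL : clausenOp h d y = 0 := clausenOp_truncSeriesMap hc
  have hyT : y.eval (T : ZMod p) = 0 := (eval_intCast_map_eq_zero_iff _ _).2 hT
  have hyT1 : (derivative y).eval (T : ZMod p) = 0 ↔ (p : ℤ) ∣ (derivative S).eval T := by
    rw [hy, derivative_map, eval_intCast_map_eq_zero_iff]
  have hyT2 : (derivative (derivative y)).eval (T : ZMod p) = 0
      ↔ (p : ℤ) ∣ (derivative (derivative S)).eval T := by
    rw [hy, derivative_map, derivative_map, eval_intCast_map_eq_zero_iff]
  have hT0 : (T : ZMod p) ≠ 0 := by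
    intro h1
    rw [h1, hy0] at hyT
    exact one_ne_zero hyT
  have hT0' : ¬ (p : ℤ) ∣ T := by rwa [← ZMod.intCast_zmod_eq_zero_iff_dvd]
  have hJ : (p : ℤ) ^ 2 ∣ (clausenIntegral h d S).eval T := by
    obtain ⟨Q, hQ⟩ := dvd_clausenIntegral_truncSeries hp hodd hc
    rw [hS, hQ, eval_mul, eval_C]
    exact dvd_mul_right _ _
  simp only [clausenIntegral, eval_add, eval_mul, eval_sub, eval_pow, eval_X, eval_natCast,
    eval_one, eval_ofNat] at hJ
  have hdisc' : (1 - 2 * (h : ZMod p) * T = 0) ↔ (p : ℤ) ∣ 1 - 2 * h * T := by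
    rw [← ZMod.intCast_zmod_eq_zero_iff_dvd]; push_cast; rfl
  obtain ⟨a, ha⟩ := hT
  generalize eval T (derivative (derivative S)) = S2 at hJ hyT2
  generalize eval T (derivative S) = S1 at hJ hyT1
  rw [ha] at hJ ⊢
  by_cases hcase : (p : ℤ) ∣ 1 - 2 * h * T
  -- Singular case: T is a simple zero modulo p, so y'(T) is a unit.
  · have hS1 : ¬ (p : ℤ) ∣ S1 := by
      rw [← hyT1]
      intro h1
      have h2 := rootMultiplicity_lt_two_of_clausenOp_eq_zero hyne (by omega) hyL (hdisc'.2 hcase)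
      have h3 := (one_lt_rootMultiplicity_iff_isRoot hyne).2 ⟨hyT, h1⟩
      omega
    obtain ⟨e, he⟩ := hdisc hcase
    -- With 2(1 - 3hT) = 3(1 - 2hT) - 1 and p² ∣ 1 - 2hT, the first integral at T reduces to -T y(T)
    -- y'(T) modulo p².
    have h1 : (p : ℤ) ^ 2 ∣ p * (a * S1 * T) := by
      obtain ⟨q, hq⟩ := hJ
      refine ⟨T ^ 2 * e * (2 * (p * a) * S2 - S1 ^ 2) + 3 * T * e * (p * a) * S1
        - 2 * d * T * a ^ 2 - q, ?_⟩
      linear_combination (-1 : ℤ) * hq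
        + (T ^ 2 * (2 * (p * a) * S2 - S1 ^ 2) + 3 * T * (p * a) * S1) * he
    rw [pow_two, mul_dvd_mul_iff_left hpz.ne_zero] at h1
    rw [pow_two, mul_dvd_mul_iff_left hpz.ne_zero]
    exact ((hpz.dvd_mul.1 ((hpz.dvd_mul.1 h1).resolve_right hT0')).resolve_right hS1)
  -- Nonsingular case: modulo p only the term in y'(T)² of the first integral remains.
  · have hS1 : (p : ℤ) ∣ S1 := by
      obtain ⟨q, hq⟩ := hJ
      have h1 : (p : ℤ) ∣ T ^ 2 * (1 - 2 * h * T) * S1 ^ 2 := by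
        refine ⟨T ^ 2 * (1 - 2 * h * T) * (2 * a * S2) + 2 * T * (1 - 3 * h * T) * a * S1
          - 2 * d * T * p * a ^ 2 - p * q, ?_⟩
        linear_combination (-1 : ℤ) * hq
      exact hpz.dvd_of_dvd_pow ((hpz.dvd_mul.1 h1).resolve_left fun h2 =>
        ((hpz.dvd_mul.1 h2).elim (fun h3 => hT0' (hpz.dvd_of_dvd_pow h3)) hcase))
    have hS2 : ¬ (p : ℤ) ∣ S2 := by
      rw [← hyT2]
      intro h1
      have h2 := rootMultiplicity_lt_three_of_clausenOp_eq_zero hyne (by omega) hyL hT0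
        (mt hdisc'.1 hcase)
      have h3 := two_lt_rootMultiplicity_of_eval_eq_zero (by
        exact_mod_cast natCast_ne_zero_of_pos_of_lt (K := ZMod p) (p := p) (n := 2) (by omega)
          (by omega)) hyne hyT (hyT1.2 hS1) h1
      omega
    obtain ⟨b, rfl⟩ := hS1
    -- Now y(T) and y'(T) are both divisible by p, so every term quadratic in them vanishes modulo
    -- p².
    have h1 : (p : ℤ) ^ 2 ∣ p * (2 * T ^ 2 * (1 - 2 * h * T) * S2 * a) := by
      obtain ⟨q, hq⟩ := hJ
      refine ⟨T ^ 2 * (1 - 2 * h * T) * b ^ 2 - 2 * T * (1 - 3 * h * T) * a * b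
          + 2 * d * T * a ^ 2 + q, ?_⟩
      linear_combination hq
    rw [pow_two, mul_dvd_mul_iff_left hpz.ne_zero] at h1
    rw [pow_two, mul_dvd_mul_iff_left hpz.ne_zero]
    have h2 : ¬ (p : ℤ) ∣ 2 := fun h2 => by have := Int.le_of_dvd two_pos h2; omega
    simp only [hpz.dvd_mul] at h1
    have h3 : ¬ (p : ℤ) ∣ T ^ 2 := fun h3 => hT0' (hpz.dvd_of_dvd_pow h3)
    tauto

theorem odd_natDegree_truncSeriesMap {K : Type*} [Field K] [IsAlgClosed K] {p : ℕ} [CharP K p]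
    (hp : p.Prime) (hodd : Odd p) {c : ℕ → ℕ} {h d : ℕ}
    (hc : ∀ k, (k + 1) ^ 3 * c (k + 1) = (2 * k + 1) * (h * k * (k + 1) + d) * c k)
    (h0 : c 0 = 1) (hdeg : ∀ k < p, p / 2 < k → p ∣ c k) {T : ℤ}
    (hT : (p : ℤ) ∣ (truncSeries c p).eval T) (hdisc : (p : ℤ) ∣ 1 - 2 * h * T) :
    Odd (truncSeriesMap K c p).natDegree := by
  have hp3 : 3 ≤ p := by have := hp.two_le; rcases hodd with ⟨k, rfl⟩; omega
  have hle : (truncSeriesMap K c p).natDegree ≤ p / 2 := natDegree_truncSeriesMap_le hdeg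
  refine odd_natDegree_of_clausenIntegral_eq_zero (p := p) (r := (T : K)) ?_ (by omega) hp3
    (clausenOp_truncSeriesMap hc) (clausenIntegral_truncSeriesMap hp hodd hc) ?_ ?_
  · rw [eval_zero_truncSeriesMap _ hp.pos h0]; exact one_ne_zero
  · exact_mod_cast (CharP.intCast_eq_zero_iff K p _).2 hdisc
  · rw [truncSeriesMap, eval_intCast_map, eq_intCast, Int.cast_id]
    exact (CharP.intCast_eq_zero_iff K p _).2 hT

end Polynomial

/-! ### Singular points 1/108 and 1/256, and the degree in the quartic case -/

theorem cubicCoeff_succ (k : ℕ) :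
    (k + 1) ^ 3 * cubicCoeff (k + 1) = (2 * k + 1) * (54 * k * (k + 1) + 12) * cubicCoeff k := by
  have hk := (Nat.cast_ne_zero (R := ℚ)).2 k.factorial_ne_zero
  have hk1 : (k : ℚ) + 1 ≠ 0 := by positivity
  have f1 := cast_factorial_succ k
  have f2 := cast_factorial_add_two (2 * k)
  have f3 := cast_factorial_add_three (3 * k)
  have : (((k + 1) ^ 3 * cubicCoeff (k + 1) : ℕ) : ℚ)
      = ((2 * k + 1) * (54 * k * (k + 1) + 12) * cubicCoeff k : ℕ) := by
    push_cast at f1 f2 f3 ⊢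
    rw [cubicCoeff_eq, cubicCoeff_eq, (by ring : 2 * (k + 1) = 2 * k + 2),
      (by ring : 3 * (k + 1) = 3 * k + 3), f1, f2, f3]
    field_simp
    ring
  exact_mod_cast this

theorem quarticCoeff_succ (k : ℕ) :
    (k + 1) ^ 3 * quarticCoeff (k + 1)
      = (2 * k + 1) * (128 * k * (k + 1) + 24) * quarticCoeff k := by
  have hk := (Nat.cast_ne_zero (R := ℚ)).2 k.factorial_ne_zero
  have hk1 : (k : ℚ) + 1 ≠ 0 := by positivity
  have f1 := cast_factorial_succ k
  have f2 := cast_factorial_succ (4 * k + 3)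
  have f3 := cast_factorial_add_three (4 * k)
  have : (((k + 1) ^ 3 * quarticCoeff (k + 1) : ℕ) : ℚ)
      = ((2 * k + 1) * (128 * k * (k + 1) + 24) * quarticCoeff k : ℕ) := by
    push_cast at f1 f2 f3 ⊢
    rw [quarticCoeff_eq, quarticCoeff_eq, (by ring : 4 * (k + 1) = 4 * k + 3 + 1), f1, f2, f3]
    field_simp
    ring
  exact_mod_cast this

theorem natDegree_truncSeriesMap_quarticCoeff {K : Type*} [Field K] {p : ℕ} [CharP K p]
    (hp : p.Prime) (hodd : Odd p) :
    (Polynomial.truncSeriesMap K quarticCoeff p).natDegree = p / 4 := by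
  have hlt : p / 4 < p := Nat.div_lt_self hp.pos (by norm_num)
  refine le_antisymm (Polynomial.natDegree_truncSeriesMap_le fun k hk h =>
    (hp.dvd_quarticCoeff_iff hk).2 (by omega)) (Polynomial.le_natDegree_of_ne_zero ?_)
  rw [Polynomial.coeff_truncSeriesMap K _ hlt, Ne, CharP.cast_eq_zero_iff K p,
    hp.dvd_quarticCoeff_iff hlt]
  rcases hodd with ⟨k, rfl⟩
  omega

/-! ### Arithmetic of ℤ_(p) and passage to integers -/

section PIntegral

variable {p : ℕ}

theorem pIntegral_iff {x : ℚ} :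
    PIntegral p x ↔ ∃ a b : ℤ, ¬ (p : ℤ) ∣ b ∧ x * b = a := by
  constructor
  · intro h
    refine ⟨x.num, x.den, by rwa [Int.natCast_dvd_natCast], ?_⟩
    exact_mod_cast Rat.mul_den_eq_num x
  · rintro ⟨a, b, hb, h⟩ hd
    have hb0 : (b : ℚ) ≠ 0 := by
      rintro h0
      exact hb (by rw [Int.cast_eq_zero.1 h0]; exact dvd_zero _)
    have hx : x = (a : ℚ) / b := by rw [← h]; field_simp
    have h1 : (((a : ℚ) / b).den : ℤ) ∣ b := by
      rw [← Rat.divInt_eq_div]; exact Rat.den_dvd a b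
    rw [← hx] at h1
    exact hb ((Int.natCast_dvd_natCast.2 hd).trans h1)

theorem PIntegral.intCast (hp : p.Prime) (n : ℤ) : PIntegral p n := by
  unfold PIntegral
  rw [Rat.den_intCast]
  exact hp.one_lt.ne' ∘ Nat.dvd_one.1

theorem PIntegral.add (hp : p.Prime) {x y : ℚ} (hx : PIntegral p x) (hy : PIntegral p y) :
    PIntegral p (x + y) := fun h =>
  (hp.dvd_mul.1 (h.trans (Rat.add_den_dvd x y))).elim hx hy

theorem PIntegral.mul (hp : p.Prime) {x y : ℚ} (hx : PIntegral p x) (hy : PIntegral p y) :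
    PIntegral p (x * y) := fun h =>
  (hp.dvd_mul.1 (h.trans (Rat.mul_den_dvd x y))).elim hx hy

theorem PIntegral.pow (hp : p.Prime) {x : ℚ} (hx : PIntegral p x) (n : ℕ) :
    PIntegral p (x ^ n) := by
  induction n with
  | zero => simpa using PIntegral.intCast hp 1
  | succ n ih => rw [pow_succ]; exact ih.mul hp hx

theorem PIntegral.inv (hp : p.Prime) {x : ℚ} (h : ¬ PCong p p x 0) : PIntegral p x⁻¹ := by
  by_cases hx : x = 0
  · rw [hx, inv_zero]; exact_mod_cast PIntegral.intCast hp 0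
  refine pIntegral_iff.2 ⟨x.den, x.num, fun hd => ?_, ?_⟩
  · obtain ⟨n, hn⟩ := hd
    have hcop : ¬ (p : ℤ) ∣ x.den := fun hd' => hp.one_lt.ne' (Nat.dvd_one.1
      (x.reduced ▸ Nat.dvd_gcd (Int.natCast_dvd.1 ⟨n, hn⟩) (Int.natCast_dvd_natCast.1 hd')))
    have hden : (x.den : ℚ) ≠ 0 := Nat.cast_ne_zero.2 x.den_nz
    refine h ⟨n / x.den, pIntegral_iff.2 ⟨n, x.den, hcop, ?_⟩, ?_⟩
    · push_cast; field_simp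
    · have h1 := Rat.mul_den_eq_num x
      rw [hn] at h1
      push_cast at h1
      field_simp
      linarith
  · have h1 := Rat.mul_den_eq_num x
    rw [← h1]
    push_cast
    field_simp

theorem PCong.refl (hp : p.Prime) (m : ℕ) (x : ℚ) : PCong p m x x :=
  ⟨0, by exact_mod_cast PIntegral.intCast hp 0, by simp⟩

theorem PCong.symm (hp : p.Prime) {m : ℕ} {x y : ℚ} (h : PCong p m x y) : PCong p m y x := by
  obtain ⟨c, hc, h⟩ := h
  refine ⟨(-1 : ℤ) * c, (PIntegral.intCast hp _).mul hp hc, ?_⟩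
  push_cast
  linarith

theorem PCong.trans (hp : p.Prime) {m : ℕ} {x y z : ℚ} (h : PCong p m x y) (h' : PCong p m y z) :
    PCong p m x z := by
  obtain ⟨c, hc, h⟩ := h
  obtain ⟨c', hc', h'⟩ := h'
  exact ⟨c + c', hc.add hp hc', by linear_combination h + h'⟩

theorem PCong.add (hp : p.Prime) {m : ℕ} {x y x' y' : ℚ} (h : PCong p m x y)
    (h' : PCong p m x' y') : PCong p m (x + x') (y + y') := by
  obtain ⟨c, hc, h⟩ := h
  obtain ⟨c', hc', h'⟩ := h'
  exact ⟨c + c', hc.add hp hc', by linear_combination h + h'⟩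

theorem PCong.mul (hp : p.Prime) {m : ℕ} {x y x' : ℚ} {y' : ℤ} (hx : PIntegral p x)
    (h : PCong p m x y) (h' : PCong p m x' y') : PCong p m (x * x') (y * y') := by
  obtain ⟨c, hc, h⟩ := h
  obtain ⟨c', hc', h'⟩ := h'
  exact ⟨x * c' + y' * c, (hx.mul hp hc').add hp ((PIntegral.intCast hp _).mul hp hc),
    by linear_combination x * h' + y' * h⟩

theorem PCong.pow (hp : p.Prime) {m : ℕ} {x : ℚ} {y : ℤ} (hx : PIntegral p x)
    (h : PCong p m x y) (n : ℕ) : PCong p m (x ^ n) ((y ^ n : ℤ) : ℚ) := by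
  induction n with
  | zero => simpa using PCong.refl hp m 1
  | succ n ih =>
    rw [pow_succ, pow_succ, Int.cast_mul]
    exact PCong.mul hp (hx.pow hp n) ih h

theorem PCong.of_sq (hp : p.Prime) {x y : ℚ} (h : PCong p (p ^ 2) x y) : PCong p p x y := by
  obtain ⟨c, hc, h⟩ := h
  refine ⟨(p : ℤ) * c, (PIntegral.intCast hp _).mul hp hc, ?_⟩
  rw [h]
  push_cast
  ring

theorem pCong_intCast_iff (hp : p.Prime) (j : ℕ) {x y : ℤ} :
    PCong p (p ^ j) x y ↔ (p : ℤ) ^ j ∣ x - y := by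
  constructor
  · rintro ⟨c, hc, h⟩
    obtain ⟨a, b, hb, hab⟩ := pIntegral_iff.1 hc
    refine (Nat.prime_iff_prime_int.1 hp).pow_dvd_of_dvd_mul_right j hb ⟨a, ?_⟩
    have : (((x - y) * b : ℤ) : ℚ) = ((p ^ j * a : ℤ) : ℚ) := by
      push_cast at h ⊢
      rw [h, ← hab]
      ring
    exact_mod_cast this
  · rintro ⟨c, hc⟩
    exact ⟨c, PIntegral.intCast hp c, by exact_mod_cast congrArg (Int.cast (R := ℚ)) hc⟩

theorem PIntegral.exists_int (hp : p.Prime) {x : ℚ} (hx : PIntegral p x) :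
    ∃ X : ℤ, PCong p (p ^ 2) x X := by
  obtain ⟨a, b, hb, hab⟩ := pIntegral_iff.1 hx
  have hcop : IsCoprime ((p : ℤ) ^ 2) b :=
    ((Nat.prime_iff_prime_int.1 hp).coprime_iff_not_dvd.2 hb).pow_left
  obtain ⟨r, s, hrs⟩ := hcop
  refine ⟨a * s, r * x, (PIntegral.intCast hp r).mul hp hx, ?_⟩
  have h1 := congrArg (Int.cast (R := ℚ)) hrs
  push_cast at h1 ⊢
  linear_combination x * (-h1) + s * hab

theorem pCong_sum_truncSeries (hp : p.Prime) {m : ℕ} (c : ℕ → ℕ) {t : ℚ} {T : ℤ}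
    (ht : PIntegral p t) (h : PCong p m t T) :
    PCong p m (∑ k ∈ Finset.range p, (c k : ℚ) * t ^ k) ((truncSeries c p).eval T : ℤ) := by
  have e : (truncSeries c p).eval T = ∑ k ∈ Finset.range p, (c k : ℤ) * T ^ k := by
    simp [truncSeries, Polynomial.eval_finsetSum]
  rw [e]
  generalize Finset.range p = s
  classical
  induction s using Finset.induction_on with
  | empty => simpa using PCong.refl hp m 0
  | insert k s hk ih =>
    rw [Finset.sum_insert hk, Finset.sum_insert hk, Int.cast_add]
    refine PCong.add hp ?_ ih
    rw [Int.cast_mul]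
    have h1 := PCong.mul hp (PIntegral.intCast hp (c k)) (PCong.refl hp m ((c k : ℤ) : ℚ))
      (PCong.pow hp ht h k)
    simpa using h1

/-- If `u` is not congruent to `1 / m`, then `1 - m * u` is a unit of `ℤ_(p)`. -/
theorem not_pCong_one_sub_mul (hp : p.Prime) {u : ℚ} (hu : PIntegral p u) {m : ℤ}
    (h : ¬ PCong p p u (1 / m)) : ¬ PCong p p (1 - m * u) 0 := by
  rintro ⟨c, hc, hcm⟩
  -- If p ∣ m, as for p = 3 and m = -3 or -27, then 1 - mu ≡ 1 for every u.
  by_cases hm : (p : ℤ) ∣ m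
  · obtain ⟨n, rfl⟩ := hm
    have h1 : PCong p (p ^ 1) (1 : ℤ) (0 : ℤ) := by
      refine ⟨c + n * u, hc.add hp ((PIntegral.intCast hp n).mul hp hu), ?_⟩
      push_cast at hcm ⊢
      linear_combination hcm
    rw [pCong_intCast_iff hp] at h1
    simp only [pow_one, sub_zero] at h1
    exact (Nat.prime_iff_prime_int.1 hp).not_dvd_one h1
  · have hm0 : (m : ℚ) ≠ 0 := by
      rintro h0
      exact hm (by rw [Int.cast_eq_zero.1 h0]; exact dvd_zero _)
    refine h ⟨c * (-1 / m), hc.mul hp (pIntegral_iff.2 ⟨-1, m, hm, ?_⟩), ?_⟩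
    · push_cast; field_simp
    · field_simp
      linear_combination -hcm

/-- Replaces the rational argument by an integer T. The defining relation is kept modulo p², not
just p, because the discriminant condition at the singular point is a statement modulo p². -/
theorem exists_int_pCong_div (hp : p.Prime) {u : ℚ} (hu : PIntegral p u) {U : ℤ}
    (hU : PCong p (p ^ 2) u U) (s m : ℤ) (a b : ℕ) (h : ¬ PCong p p u (1 / m)) :
    PIntegral p (s * u ^ a / (1 - m * u) ^ b) ∧ ¬ (p : ℤ) ∣ 1 - m * U ∧
      ∃ T : ℤ, PCong p (p ^ 2) (s * u ^ a / (1 - m * u) ^ b) T ∧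
        (p : ℤ) ^ 2 ∣ T * (1 - m * U) ^ b - s * U ^ a := by
  have h0 := not_pCong_one_sub_mul hp hu h
  have hs : PIntegral p (s * u ^ a) := (PIntegral.intCast hp s).mul hp (hu.pow hp a)
  have hv : PIntegral p (1 - m * u) := by
    have := (PIntegral.intCast hp 1).add hp ((PIntegral.intCast hp (-m)).mul hp hu)
    push_cast at this
    rwa [neg_mul, ← sub_eq_add_neg] at this
  have hvV : PCong p (p ^ 2) (1 - m * u) ((1 - m * U : ℤ) : ℚ) := by
    have := PCong.add hp (PCong.refl hp (p ^ 2) 1)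
      (PCong.mul hp (PIntegral.intCast hp (-m)) (PCong.refl hp (p ^ 2) ((-m : ℤ) : ℚ)) hU)
    push_cast at this ⊢
    rwa [neg_mul, neg_mul, ← sub_eq_add_neg, ← sub_eq_add_neg] at this
  have ht : PIntegral p (s * u ^ a / (1 - m * u) ^ b) := by
    rw [div_eq_mul_inv, ← inv_pow]
    exact hs.mul hp ((PIntegral.inv hp h0).pow hp b)
  have hv0 : (1 - m * u : ℚ) ≠ 0 := fun h1 => h0 (by rw [h1]; exact PCong.refl hp p 0)
  refine ⟨ht, fun h1 => h0 ?_, ?_⟩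
  · have h2 : PCong p (p ^ 1) ((1 - m * U : ℤ) : ℚ) ((0 : ℤ) : ℚ) := by
      rw [pCong_intCast_iff hp]; simpa using h1
    rw [pow_one, Int.cast_zero] at h2
    exact PCong.trans hp (PCong.of_sq hp hvV) h2
  · obtain ⟨T, hT⟩ := ht.exists_int hp
    refine ⟨T, hT, ?_⟩
    rw [← pCong_intCast_iff hp]
    have h1 := PCong.mul hp ht hT (PCong.pow hp hv hvV b)
    rw [div_mul_cancel₀ _ (pow_ne_zero b hv0)] at h1
    have h2 := PCong.mul hp (PIntegral.intCast hp s) (PCong.refl hp (p ^ 2) s) (PCong.pow hp hu hU a)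
    have h3 := PCong.trans hp (PCong.symm hp h1) h2
    push_cast at h3 ⊢
    exact h3

end PIntegral

/-! ### Discriminants and conclusion -/

theorem dvd_eval_truncSeries_iff {p : ℕ} (c : ℕ → ℕ) (T : ℤ) :
    (p : ℤ) ∣ (truncSeries c p).eval T
      ↔ ∑ k ∈ Finset.range p, (c k : ZMod p) * (T : ZMod p) ^ k = 0 := by
  rw [← ZMod.intCast_zmod_eq_zero_iff_dvd]
  simp [truncSeries, Polynomial.eval_finsetSum]

theorem sum_pCong_zero_iff {p : ℕ} (hp : p.Prime) (c : ℕ → ℕ) (j : ℕ) {t : ℚ} {T : ℤ}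
    (ht : PIntegral p t) (h : PCong p (p ^ j) t T) :
    PCong p (p ^ j) (∑ k ∈ Finset.range p, (c k : ℚ) * t ^ k) 0
      ↔ (p : ℤ) ^ j ∣ (truncSeries c p).eval T := by
  have h1 := pCong_sum_truncSeries hp c ht h
  have h2 := pCong_intCast_iff hp j (x := (truncSeries c p).eval T) (y := 0)
  rw [sub_zero, Int.cast_zero] at h2
  rw [← h2]
  exact ⟨fun h3 => PCong.trans hp (PCong.symm hp h1) h3, fun h3 => PCong.trans hp h1 h3⟩

theorem cubicSum_eq (p : ℕ) (x : ℚ) :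
    cubicSum p x = ∑ k ∈ Finset.range p, (cubicCoeff k : ℚ) * x ^ k := by
  simp [cubicSum, cubicCoeff]

theorem quarticSum_eq (p : ℕ) (x : ℚ) :
    quarticSum p x = ∑ k ∈ Finset.range p, (quarticCoeff k : ℚ) * x ^ k := by
  simp [quarticSum, quarticCoeff]

theorem ZMod.intCast_eq_of_sq_dvd_sub {p : ℕ} {x y : ℤ} (h : (p : ℤ) ^ 2 ∣ x - y) :
    (x : ZMod p) = y := by
  rw [← sub_eq_zero, ← Int.cast_sub, ZMod.intCast_zmod_eq_zero_iff_dvd]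
  exact (dvd_pow_self _ two_ne_zero).trans h

theorem cubic_sq_dvd_eval {p : ℕ} (hp : p.Prime) (hodd : Odd p) {U T T' : ℤ}
    (hU : ¬ (p : ℤ) ∣ 1 - 4 * U) (hU' : ¬ (p : ℤ) ∣ 1 - 16 * U)
    (hT : (p : ℤ) ^ 2 ∣ T * (1 - 4 * U) ^ 3 - U ^ 2)
    (hT' : (p : ℤ) ^ 2 ∣ T' * (1 - 16 * U) ^ 3 - -U)
    (h : (p : ℤ) ∣ (truncSeries cubicCoeff p).eval T) :
    (p : ℤ) ^ 2 ∣ (truncSeries cubicCoeff p).eval T' := by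
  have : Fact p.Prime := ⟨hp⟩
  have hpz : Prime (p : ℤ) := Nat.prime_iff_prime_int.1 hp
  have h1 := ZMod.intCast_eq_of_sq_dvd_sub hT
  have h2 := ZMod.intCast_eq_of_sq_dvd_sub hT'
  have hV := hU
  have hV' := hU'
  rw [← ZMod.intCast_zmod_eq_zero_iff_dvd] at hV hV'
  push_cast at h1 h2 hV hV'
  rw [dvd_eval_truncSeries_iff, ZMod.cubic_sum_eq hV hV' h1 h2, ← dvd_eval_truncSeries_iff] at h
  refine Polynomial.sq_dvd_eval_truncSeries hp hodd cubicCoeff_succ (by decide)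
    (fun k hk hk' => hp.dvd_cubicCoeff hk (by omega)) h fun hd => ?_
  push_cast at hd ⊢
  obtain ⟨q, hq⟩ := hT'
  -- From the factorization (1 - 16U)³ + 108U = (1 + 32U)²(1 - 4U), where 1 - 4U is a unit: a zero
  -- modulo p comes from the squared factor, hence is a zero modulo p².
  have key : (1 - 108 * T') * (1 - 16 * U) ^ 3
      = (1 + 32 * U) ^ 2 * (1 - 4 * U) - 108 * (p ^ 2 * q) := by
    linear_combination -108 * hq
  have h3 : (p : ℤ) ∣ (1 + 32 * U) ^ 2 * (1 - 4 * U) := by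
    have h4 : (p : ℤ) ∣ 108 * (p ^ 2 * q) := ⟨108 * (p * q), by ring⟩
    have h5 := dvd_add (hd.mul_right ((1 - 16 * U) ^ 3)) h4
    rwa [key, sub_add_cancel] at h5
  have h4 : (p : ℤ) ∣ 1 + 32 * U := hpz.dvd_of_dvd_pow ((hpz.dvd_mul.1 h3).resolve_right hU)
  refine hpz.pow_dvd_of_dvd_mul_right 2 (fun h5 => hU' (hpz.dvd_of_dvd_pow h5))
      (b := (1 - 16 * U) ^ 3) ?_
  rw [key]
  exact dvd_sub ((pow_dvd_pow_of_dvd h4 2).mul_right _) ⟨108 * q, by ring⟩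

theorem quartic_sq_dvd_eval {p : ℕ} (hp : p.Prime) (hodd : Odd p) {U T T' : ℤ}
    (hU : ¬ (p : ℤ) ∣ 1 + 3 * U) (hU' : ¬ (p : ℤ) ∣ 1 + 27 * U)
    (hT : (p : ℤ) ^ 2 ∣ T * (1 + 3 * U) ^ 4 - U ^ 3)
    (hT' : (p : ℤ) ^ 2 ∣ T' * (1 + 27 * U) ^ 4 - U)
    (h : (p : ℤ) ∣ (truncSeries quarticCoeff p).eval T) :
    (p : ℤ) ^ 2 ∣ (truncSeries quarticCoeff p).eval T' := by
  have : Fact p.Prime := ⟨hp⟩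
  have hpz : Prime (p : ℤ) := Nat.prime_iff_prime_int.1 hp
  have h1 := ZMod.intCast_eq_of_sq_dvd_sub hT
  have h2 := ZMod.intCast_eq_of_sq_dvd_sub hT'
  have hV := hU
  have hV' := hU'
  rw [← ZMod.intCast_zmod_eq_zero_iff_dvd] at hV hV'
  push_cast at h1 h2 hV hV'
  rw [dvd_eval_truncSeries_iff, ZMod.quartic_sum_eq hV hV' h1 h2, ← dvd_eval_truncSeries_iff] at h
  have hdeg : ∀ k < p, p / 2 < k → p ∣ quarticCoeff k := fun k hk hk' =>
    (hp.dvd_quarticCoeff_iff hk).2 (by omega)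
  refine Polynomial.sq_dvd_eval_truncSeries hp hodd quarticCoeff_succ (by decide) hdeg h
    fun hd => ?_
  -- A zero at the singular point makes the degree p / 4 odd, so p ≡ 5 or 7 modulo 8.
  have hodd4 := Polynomial.odd_natDegree_truncSeriesMap (K := AlgebraicClosure (ZMod p)) hp hodd
    quarticCoeff_succ (by decide) hdeg h hd
  rw [natDegree_truncSeriesMap_quarticCoeff hp hodd] at hodd4
  push_cast at hd ⊢
  obtain ⟨q, hq⟩ := hT'
  have key : (1 - 256 * T') * (1 + 27 * U) ^ 4
      = (1 - 81 * U) ^ 2 * (1 + 14 * U + 81 * U ^ 2) - 256 * (p ^ 2 * q) := by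
    linear_combination -256 * hq
  have h3 : (p : ℤ) ∣ (1 - 81 * U) ^ 2 * (1 + 14 * U + 81 * U ^ 2) := by
    have h4 : (p : ℤ) ∣ 256 * (p ^ 2 * q) := ⟨256 * (p * q), by ring⟩
    have h5 := dvd_add (hd.mul_right ((1 + 27 * U) ^ 4)) h4
    rwa [key, sub_add_cancel] at h5
  rcases hpz.dvd_mul.1 h3 with h4 | h4
  · have h4 := hpz.dvd_of_dvd_pow h4
    refine hpz.pow_dvd_of_dvd_mul_right 2 (fun h5 => hU' (hpz.dvd_of_dvd_pow h5))
      (b := (1 + 27 * U) ^ 4) ?_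
    rw [key]
    exact dvd_sub ((pow_dvd_pow_of_dvd h4 2).mul_right _) ⟨256 * q, by ring⟩
  · exfalso
    have hp2 : p ≠ 2 := by rintro rfl; exact absurd hodd (by decide)
    have h20 : (2 : ZMod p) ≠ 0 := by
      have h6 : ¬ p ∣ 2 := fun h6 => hp2 ((Nat.prime_dvd_prime_iff_eq hp Nat.prime_two).1 h6)
      rw [← ZMod.natCast_eq_zero_iff] at h6
      exact_mod_cast h6
    rw [← ZMod.intCast_zmod_eq_zero_iff_dvd] at h4
    push_cast at h4
    have h5 : IsSquare (-2 : ZMod p) := by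
      -- Completing the square: (81U + 7)² = 81(1 + 14U + 81U²) - 32. That -2 is a square gives p ≡
      -- 1 or 3 modulo 8, so p / 4 is even.
      refine ⟨(81 * U + 7) / 2 ^ 2, ?_⟩
      field_simp
      linear_combination -81 * h4
    rcases (ZMod.exists_sq_eq_neg_two_iff hp2).1 h5 with h6 | h6 <;>
    · obtain ⟨k, hk⟩ := hodd4
      omega

theorem theorem2p4 (p : ℕ) (hp : p.Prime) (hodd : Odd p) (u : ℚ) (hu : PIntegral p u) :
    (¬ PCong p p u (1 / 4) → ¬ PCong p p u (1 / 16) →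
      PCong p p (cubicSum p (u ^ 2 / (1 - 4 * u) ^ 3)) 0 →
      PCong p (p ^ 2) (cubicSum p (-u / (1 - 16 * u) ^ 3)) 0) ∧
    (¬ PCong p p u (-1 / 3) → ¬ PCong p p u (-1 / 27) →
      PCong p p (quarticSum p (u ^ 3 / (1 + 3 * u) ^ 4)) 0 →
      PCong p (p ^ 2) (quarticSum p (u / (1 + 27 * u) ^ 4)) 0) := by
  obtain ⟨U, hU⟩ := hu.exists_int hp
  have hmod : ∀ (c : ℕ → ℕ) {t : ℚ} {T : ℤ}, PIntegral p t → PCong p (p ^ 2) t T →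
      (PCong p p (∑ k ∈ Finset.range p, (c k : ℚ) * t ^ k) 0
        ↔ (p : ℤ) ∣ (truncSeries c p).eval T) := fun c t T ht hT => by
    have := sum_pCong_zero_iff hp c 1 ht (by simpa using PCong.of_sq hp hT)
    simpa using this
  refine ⟨fun h1 h2 h => ?_, fun h1 h2 h => ?_⟩
  · obtain ⟨ht, hV, T, hT, hTU⟩ := exists_int_pCong_div hp hu hU 1 4 2 3 (by simpa using h1)
    obtain ⟨ht', hV', T', hT', hTU'⟩ := exists_int_pCong_div hp hu hU (-1) 16 1 3 (by simpa using h2)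
    simp only [Int.cast_one, one_mul, Int.cast_neg, Int.cast_ofNat, neg_mul, pow_one] at *
    rw [cubicSum_eq, hmod _ ht hT] at h
    rw [cubicSum_eq, sum_pCong_zero_iff hp _ 2 ht' hT']
    exact cubic_sq_dvd_eval hp hodd hV hV' hTU hTU' h
  · obtain ⟨ht, hV, T, hT, hTU⟩ := exists_int_pCong_div hp hu hU 1 (-3) 3 4
      (by convert h1 using 1; norm_num)
    obtain ⟨ht', hV', T', hT', hTU'⟩ := exists_int_pCong_div hp hu hU 1 (-27) 1 4
      (by convert h2 using 1; norm_num)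
    simp only [Int.cast_one, one_mul, Int.cast_neg, Int.cast_ofNat, neg_mul, pow_one,
      sub_neg_eq_add] at *
    rw [quarticSum_eq, hmod _ ht hT] at h
    rw [quarticSum_eq, sum_pCong_zero_iff hp _ 2 ht' hT']
    exact quartic_sq_dvd_eval hp hodd hV hV' hTU hTU' h
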